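/- Let $\mathbb N=\{1,2,\dots\}$ and let $c_{00}$ be the space of finitely supported real sequences with unit vectors $(e_i)_{i\ge1}$; for $x=\sum_i a_ie_i\in c_{00}$ and $E\subset\mathbb N$ put $Ex=\sum_{i\in E}a_ie_i$. For finite sets $E,F\subset\mathbb N$ write $E<F$ if every element of $E$ is smaller than every element of $F$. The Schreier families are $$\mathcal F_0=\{\emptyset\}\cup\{\{n\}:n\in\mathbb N\},\qquad \mathcal F_{n+1}=\{\emptyset\}\cup\Big\{\bigcup_{i=1}^dA_i:\ d\in\mathbb N,\ A_i\in\mathcal F_n,\ d\le A_1<A_2<\dots<A_d\Big\},$$ where $d\le A_1<\dots<A_d$ means that all elements of the $A_i$ are at least $d$ and $A_i<A_j$ for $i<j$. A finite sequence $(E_i)_{i=1}^d$ of nonempty finite subsets of $\mathbb N$ is $\mathcal F_k$-admissible if $E_1<\dots<E_d$ and $\{\min E_1,\dots,\min E_d\}\in\mathcal F_k$. A sequence $(\theta_n)_{n\ge1}$ of reals is called regular if $\theta_n\in(0,1)$ for all $n$, $(\theta_n)$ is non-increasing with $\theta_n\to0$, and $\theta_{n+m}\ge\theta_n\theta_m$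 for all $n,m$. For such a sequence, $T[(\mathcal F_n,\theta_n)_{n=1}^\infty]$ is the completion of $c_{00}$ under the unique norm satisfying $$\|x\|=\max\Big\{\|x\|_\infty,\ \sup_{k\ge1}\sup\Big\{\theta_k\sum_{i=1}^d\|E_ix\|:\ d\in\mathbb N,\ (E_i)_{i=1}^d\text{ is }\mathcal F_k\text{-admissible}\Big\}\Big\}.$$ The coordinate functionals $e_i^*$ on $c_{00}$ extend continuously to this space, and the support of a vector $y$ is $\{i:e_i^*(y)\neq0\}$. An infinite-dimensional block subspace is the closed linear span of a sequence $(u_k)_{k\ge1}$ of nonzero vectors of $c_{00}$ with $\operatorname{supp}u_1<\operatorname{supp}u_2<\cdots$. **Theorem 1.6.** Let $(\theta_n)_{n=1}^\infty$ be a regular sequence with $\lim_n\theta_n^{1/n}=1$ and let $X=T[(\mathcal F_n,\theta_n)_{n=1}^\infty]$. Then for every $\varepsilon>0$, every infinite-dimensional block subspace $Y$ of $X$ and every $n\in\mathbb N$ there are vectors $y_1,\dots,y_n\in Y$ with pairwise disjoint supports such that $(y_i)_{i=1}^n$ is $(1+\varepsilon)$-equivalent to the canonical basis of $\ell_\infty^n$,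 that is, for some $A,B>0$ with $AB\le1+\varepsilon$, $$A^{-1}\max_{1\le i\le n}|a_i|\ \le\ \Big\|\sum_{i=1}^na_iy_i\Big\|\ \le\ B\max_{1\le i\le n}|a_i|\qquad\text{for all }a_1,\dots,a_n\in\mathbb R.$$ -/

import Mathlib

open Filter Topology

noncomputable section

namespace MixedTsirelson

/-! The positive integers `ℕ+` play the role of `ℕ = {1, 2, …}`; `ℕ+ →₀ ℝ` is `c₀₀`. -/

/-- `E < F`: every element of `E` is smaller than every element of `F`
(in particular this holds when one of them is empty). -/
def Before (E F : Finset ℕ+) : Prop := ∀ a ∈ E, ∀ b ∈ F, a < b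

/-- `E₁ < E₂ < ⋯ < E_d`. -/
def Successive {d : ℕ} (E : Fin d → Finset ℕ+) : Prop := ∀ i j, i < j → Before (E i) (E j)

/-- The Schreier families `𝓕₀, 𝓕₁, 𝓕₂, …` of finite order:
`𝓕₀` consists of the empty set and the singletons, and `𝓕ₙ₊₁` consists of the unions
`A₁ ∪ ⋯ ∪ A_d` with `A_i ∈ 𝓕ₙ` and `d ≤ A₁ < ⋯ < A_d`
(`d = 0` gives the empty set). -/
def schreier : ℕ → Set (Finset ℕ+)
  | 0 => {A | A = ∅ ∨ ∃ n, A = {n}}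
  | n + 1 => {A | ∃ (d : ℕ) (B : Fin d → Finset ℕ+), (∀ i, B i ∈ schreier n) ∧ Successive B ∧
      (∀ i, ∀ a ∈ B i, d ≤ (a : ℕ)) ∧ A = Finset.univ.biUnion B}

/-- A finite sequence of (nonempty, finite) sets is `𝓜`-admissible if `E₁ < ⋯ < E_d` and
`{min E₁, …, min E_d} ∈ 𝓜`. -/
def Admissible (M : Set (Finset ℕ+)) {d : ℕ} (E : Fin d → Finset ℕ+) : Prop :=
  Successive E ∧ ∃ h : ∀ i, (E i).Nonempty, Finset.univ.image (fun i => (E i).min' (h i)) ∈ M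

/-- The restriction `Ex` of `x ∈ c₀₀` to the set `E`. -/
def restrict (E : Finset ℕ+) (x : ℕ+ →₀ ℝ) : ℕ+ →₀ ℝ := x.filter (fun i => i ∈ E)

/-- The norm `‖x‖_∞`. -/
def supNorm (x : ℕ+ →₀ ℝ) : ℝ := ⨆ i, |x i|

/-- The numbers `θ_k ∑ N(E_i x)`, where `k ≥ 1` and `(E_i)` is `𝓜_k`-admissible. -/
def admissibleSums (M : ℕ+ → Set (Finset ℕ+)) (θ : ℕ+ → ℝ) (N : (ℕ+ →₀ ℝ) → ℝ)
    (x : ℕ+ →₀ ℝ) : Set ℝ :=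
  {r | ∃ (k : ℕ+) (d : ℕ) (E : Fin d → Finset ℕ+), Admissible (M k) E ∧
    r = θ k * ∑ i, N (restrict (E i) x)}

/-- The right-hand side of the implicit equation for the mixed Tsirelson norm:
`max {‖x‖_∞, sup_k sup {θ_k ∑ N(E_i x) : (E_i) is 𝓜_k-admissible}}`. -/
def step (M : ℕ+ → Set (Finset ℕ+)) (θ : ℕ+ → ℝ) (N : (ℕ+ →₀ ℝ) → ℝ) (x : ℕ+ →₀ ℝ) : ℝ :=
  max (supNorm x) (sSup (admissibleSums M θ N x))

/-- The iterates `‖·‖_∞`, `step ‖·‖_∞`, `step (step ‖·‖_∞)`, …. -/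
def normIter (M : ℕ+ → Set (Finset ℕ+)) (θ : ℕ+ → ℝ) : ℕ → (ℕ+ →₀ ℝ) → ℝ
  | 0 => supNorm
  | m + 1 => step M θ (normIter M θ m)

/-- The mixed Tsirelson norm on `c₀₀`: the limit (supremum) of the increasing sequence of iterates.
It solves the implicit equation `‖x‖ = step ‖·‖ x`, see `tsirelsonNorm_eq`, and is its only
nonnegative solution that vanishes at `0` if `sup θ_k < 1`, see `tsirelsonNorm_unique`. -/
def tsirelsonNorm (M : ℕ+ → Set (Finset ℕ+)) (θ : ℕ+ → ℝ) (x : ℕ+ →₀ ℝ) : ℝ :=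
  ⨆ m, normIter M θ m x

section Facts

/-- The `ℓ₁`-norm; only used to bound the suprema above. -/
def l1 (x : ℕ+ →₀ ℝ) : ℝ := ∑ i ∈ x.support, |x i|

theorem l1_nonneg (x : ℕ+ →₀ ℝ) : 0 ≤ l1 x := Finset.sum_nonneg fun _ _ => abs_nonneg _

theorem abs_le_l1 (x : ℕ+ →₀ ℝ) (i : ℕ+) : |x i| ≤ l1 x := by
  by_cases h : i ∈ x.support
  · exact Finset.single_le_sum (f := fun i => |x i|) (fun _ _ => abs_nonneg _) h
  · rw [Finsupp.notMem_support_iff.1 h, abs_zero]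
    exact l1_nonneg x

theorem bddAbove_abs (x : ℕ+ →₀ ℝ) : BddAbove (Set.range fun i => |x i|) :=
  ⟨l1 x, by rintro _ ⟨i, rfl⟩; exact abs_le_l1 x i⟩

theorem abs_le_supNorm (x : ℕ+ →₀ ℝ) (i : ℕ+) : |x i| ≤ supNorm x := le_ciSup (bddAbove_abs x) i

theorem supNorm_nonneg (x : ℕ+ →₀ ℝ) : 0 ≤ supNorm x := (abs_nonneg _).trans (abs_le_supNorm x 1)

theorem supNorm_le_l1 (x : ℕ+ →₀ ℝ) : supNorm x ≤ l1 x := ciSup_le (abs_le_l1 x)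

theorem supNorm_add_le (x y : ℕ+ →₀ ℝ) : supNorm (x + y) ≤ supNorm x + supNorm y :=
  ciSup_le fun i => (abs_add_le (x i) (y i)).trans
    (add_le_add (abs_le_supNorm x i) (abs_le_supNorm y i))

theorem supNorm_smul (c : ℝ) (x : ℕ+ →₀ ℝ) : supNorm (c • x) = |c| * supNorm x := by
  simp only [supNorm, Finsupp.smul_apply, smul_eq_mul, abs_mul]
  rw [Real.mul_iSup_of_nonneg (abs_nonneg c)]

theorem sum_l1_restrict_le {d : ℕ} (E : Fin d → Finset ℕ+) (hE : Successive E) (x : ℕ+ →₀ ℝ) :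
    ∑ i, l1 (restrict (E i) x) ≤ l1 x := by
  have h1 : ∀ i, l1 (restrict (E i) x) = ∑ a ∈ x.support.filter (· ∈ E i), |x a| := by
    intro i
    rw [l1, restrict, Finsupp.support_filter]
    refine Finset.sum_congr rfl fun a ha => ?_
    rw [Finsupp.filter_apply_pos (fun i_1 => i_1 ∈ E i) x (Finset.mem_filter.1 ha).2]
  simp only [h1]
  have key : ∀ i j, i < j → Disjoint (x.support.filter (· ∈ E i)) (x.support.filter (· ∈ E j)) := by
    intro i j hij
    rw [Finset.disjoint_left]
    intro a ha hb
    exact lt_irrefl a (hE i j hij a (Finset.mem_filter.1 ha).2 a (Finset.mem_filter.1 hb).2)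
  rw [← Finset.sum_biUnion]
  · refine Finset.sum_le_sum_of_subset_of_nonneg ?_ fun _ _ _ => abs_nonneg _
    intro a ha
    obtain ⟨i, -, hi⟩ := Finset.mem_biUnion.1 ha
    exact (Finset.mem_filter.1 hi).1
  · intro i _ j _ hij
    rcases lt_or_gt_of_ne hij with h | h
    · exact key i j h
    · exact (key j i h).symm

variable {M : ℕ+ → Set (Finset ℕ+)} {θ : ℕ+ → ℝ} {N N' : (ℕ+ →₀ ℝ) → ℝ}

theorem sums_le_l1 (hθ : ∀ k, θ k ∈ Set.Ioo (0 : ℝ) 1) (hN : ∀ x, 0 ≤ N x ∧ N x ≤ l1 x)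
    (x : ℕ+ →₀ ℝ) : ∀ r ∈ admissibleSums M θ N x, 0 ≤ r ∧ r ≤ l1 x := by
  rintro _ ⟨k, d, E, hE, rfl⟩
  have h0 : 0 ≤ ∑ i, N (restrict (E i) x) := Finset.sum_nonneg fun i _ => (hN _).1
  have h1 : ∑ i, N (restrict (E i) x) ≤ l1 x :=
    (Finset.sum_le_sum fun i _ => (hN _).2).trans (sum_l1_restrict_le E hE.1 x)
  exact ⟨mul_nonneg (hθ k).1.le h0, (mul_le_of_le_one_left h0 (hθ k).2.le).trans h1⟩

theorem bdd_sums (hθ : ∀ k, θ k ∈ Set.Ioo (0 : ℝ) 1) (hN : ∀ x, 0 ≤ N x ∧ N x ≤ l1 x)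
    (x : ℕ+ →₀ ℝ) : BddAbove (admissibleSums M θ N x) :=
  ⟨l1 x, fun r hr => (sums_le_l1 hθ hN x r hr).2⟩

theorem step_bounds (hθ : ∀ k, θ k ∈ Set.Ioo (0 : ℝ) 1) (hN : ∀ x, 0 ≤ N x ∧ N x ≤ l1 x)
    (x : ℕ+ →₀ ℝ) : 0 ≤ step M θ N x ∧ step M θ N x ≤ l1 x :=
  ⟨le_max_of_le_left (supNorm_nonneg x), max_le (supNorm_le_l1 x)
    (Real.sSup_le (fun r hr => (sums_le_l1 hθ hN x r hr).2) (l1_nonneg x))⟩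

theorem le_step (hθ : ∀ k, θ k ∈ Set.Ioo (0 : ℝ) 1) (hN : ∀ x, 0 ≤ N x ∧ N x ≤ l1 x)
    (x : ℕ+ →₀ ℝ) {k : ℕ+} {d : ℕ} {E : Fin d → Finset ℕ+} (hE : Admissible (M k) E) :
    θ k * ∑ i, N (restrict (E i) x) ≤ step M θ N x :=
  le_max_of_le_right (le_csSup (bdd_sums hθ hN x) ⟨k, d, E, hE, rfl⟩)

theorem step_le {x : ℕ+ →₀ ℝ} {B : ℝ} (h0 : supNorm x ≤ B)
    (h : ∀ (k : ℕ+) (d : ℕ) (E : Fin d → Finset ℕ+), Admissible (M k) E →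
      θ k * ∑ i, N (restrict (E i) x) ≤ B) : step M θ N x ≤ B :=
  max_le h0 (Real.sSup_le (by rintro _ ⟨k, d, E, hE, rfl⟩; exact h k d E hE)
    ((supNorm_nonneg x).trans h0))

theorem step_mono (hθ : ∀ k, θ k ∈ Set.Ioo (0 : ℝ) 1) (hN' : ∀ x, 0 ≤ N' x ∧ N' x ≤ l1 x)
    (h : ∀ x, N x ≤ N' x) (x : ℕ+ →₀ ℝ) : step M θ N x ≤ step M θ N' x :=
  step_le (le_max_left _ _) fun k _ _ hE =>
    (mul_le_mul_of_nonneg_left (Finset.sum_le_sum fun _ _ => h _) (hθ k).1.le).trans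
      (le_step hθ hN' x hE)

theorem normIter_bounds (hθ : ∀ k, θ k ∈ Set.Ioo (0 : ℝ) 1) (m : ℕ) :
    ∀ x, 0 ≤ normIter M θ m x ∧ normIter M θ m x ≤ l1 x := by
  induction m with
  | zero => exact fun x => ⟨supNorm_nonneg x, supNorm_le_l1 x⟩
  | succ m ih => exact step_bounds hθ ih

theorem normIter_mono (hθ : ∀ k, θ k ∈ Set.Ioo (0 : ℝ) 1) (x : ℕ+ →₀ ℝ) :
    Monotone fun m => normIter M θ m x := by
  have h : ∀ m x, normIter M θ m x ≤ normIter M θ (m + 1) x := by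
    intro m
    induction m with
    | zero => exact fun x => le_max_left _ _
    | succ m ih => exact step_mono hθ (normIter_bounds hθ (m + 1)) ih
  exact monotone_nat_of_le_succ fun m => h m x

theorem bddAbove_normIter (hθ : ∀ k, θ k ∈ Set.Ioo (0 : ℝ) 1) (x : ℕ+ →₀ ℝ) :
    BddAbove (Set.range fun m => normIter M θ m x) :=
  ⟨l1 x, by rintro _ ⟨m, rfl⟩; exact (normIter_bounds hθ m x).2⟩

theorem tendsto_normIter (hθ : ∀ k, θ k ∈ Set.Ioo (0 : ℝ) 1) (x : ℕ+ →₀ ℝ) :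
    Tendsto (fun m => normIter M θ m x) atTop (𝓝 (tsirelsonNorm M θ x)) :=
  tendsto_atTop_ciSup (normIter_mono hθ x) (bddAbove_normIter hθ x)

theorem normIter_le (hθ : ∀ k, θ k ∈ Set.Ioo (0 : ℝ) 1) (m : ℕ) (x : ℕ+ →₀ ℝ) :
    normIter M θ m x ≤ tsirelsonNorm M θ x := le_ciSup (bddAbove_normIter hθ x) m

theorem tsirelsonNorm_bounds (hθ : ∀ k, θ k ∈ Set.Ioo (0 : ℝ) 1) (x : ℕ+ →₀ ℝ) :
    0 ≤ tsirelsonNorm M θ x ∧ tsirelsonNorm M θ x ≤ l1 x :=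
  ⟨(normIter_bounds hθ 0 x).1.trans (normIter_le hθ 0 x),
    ciSup_le fun m => (normIter_bounds hθ m x).2⟩

/-- The implicit equation of the mixed Tsirelson norm. -/
theorem tsirelsonNorm_eq (hθ : ∀ k, θ k ∈ Set.Ioo (0 : ℝ) 1) (x : ℕ+ →₀ ℝ) :
    tsirelsonNorm M θ x = max (supNorm x) (sSup (admissibleSums M θ (tsirelsonNorm M θ) x)) := by
  change _ = step M θ (tsirelsonNorm M θ) x
  refine le_antisymm (ciSup_le fun m => ?_) (step_le (normIter_le hθ 0 x) fun k d E hE => ?_)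
  · cases m with
    | zero => exact le_max_left _ _
    | succ m => exact step_mono hθ (tsirelsonNorm_bounds hθ) (normIter_le hθ m) x
  · have : Tendsto (fun m => θ k * ∑ i, normIter M θ m (restrict (E i) x)) atTop
        (𝓝 (θ k * ∑ i, tsirelsonNorm M θ (restrict (E i) x))) :=
      (tendsto_finsetSum _ fun i _ => tendsto_normIter hθ _).const_mul _
    exact le_of_tendsto this (Eventually.of_forall fun m =>
      (le_step hθ (normIter_bounds hθ m) x hE).trans (normIter_le hθ (m + 1) x))

theorem normIter_add_le (hθ : ∀ k, θ k ∈ Set.Ioo (0 : ℝ) 1) (m : ℕ) :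
    ∀ x y, normIter M θ m (x + y) ≤ normIter M θ m x + normIter M θ m y := by
  induction m with
  | zero => exact supNorm_add_le
  | succ m ih =>
    intro x y
    refine step_le ((supNorm_add_le x y).trans (add_le_add (le_max_left _ _) (le_max_left _ _)))
      fun k d E hE => ?_
    have h := normIter_bounds (M := M) hθ m
    calc θ k * ∑ i, normIter M θ m (restrict (E i) (x + y))
        ≤ θ k * ∑ i, (normIter M θ m (restrict (E i) x) + normIter M θ m (restrict (E i) y)) := by
          refine mul_le_mul_of_nonneg_left (Finset.sum_le_sum fun i _ => ?_) (hθ k).1.le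
          rw [restrict, Finsupp.filter_add]
          exact ih _ _
      _ = θ k * ∑ i, normIter M θ m (restrict (E i) x)
          + θ k * ∑ i, normIter M θ m (restrict (E i) y) := by
          rw [Finset.sum_add_distrib, mul_add]
      _ ≤ _ := add_le_add (le_step hθ h x hE) (le_step hθ h y hE)

open scoped Pointwise in
theorem normIter_smul (m : ℕ) :
    ∀ (c : ℝ) (x : ℕ+ →₀ ℝ), normIter M θ m (c • x) = |c| * normIter M θ m x := by
  induction m with
  | zero => exact supNorm_smul
  | succ m ih =>
    intro c x
    have h : admissibleSums M θ (normIter M θ m) (c • x)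
        = |c| • admissibleSums M θ (normIter M θ m) x := by
      have e : ∀ (k : ℕ+) (d : ℕ) (E : Fin d → Finset ℕ+),
          θ k * ∑ i, normIter M θ m (restrict (E i) (c • x))
            = |c| * (θ k * ∑ i, normIter M θ m (restrict (E i) x)) := by
        intro k d E
        simp only [restrict, Finsupp.filter_smul, ih, ← Finset.mul_sum]
        ring
      ext r
      rw [Set.mem_smul_set]
      constructor
      · rintro ⟨k, d, E, hE, rfl⟩
        exact ⟨_, ⟨k, d, E, hE, rfl⟩, (e k d E).symm⟩
      · rintro ⟨_, ⟨k, d, E, hE, rfl⟩, rfl⟩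
        exact ⟨k, d, E, hE, (e k d E).symm⟩
    change max _ _ = |c| * max _ _
    rw [h, Real.sSup_smul_of_nonneg (abs_nonneg c), supNorm_smul, smul_eq_mul,
      mul_max_of_nonneg _ _ (abs_nonneg c)]

theorem tsirelsonNorm_add_le (hθ : ∀ k, θ k ∈ Set.Ioo (0 : ℝ) 1) (x y : ℕ+ →₀ ℝ) :
    tsirelsonNorm M θ (x + y) ≤ tsirelsonNorm M θ x + tsirelsonNorm M θ y :=
  ciSup_le fun m => (normIter_add_le hθ m x y).trans
    (add_le_add (normIter_le hθ m x) (normIter_le hθ m y))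

theorem tsirelsonNorm_smul (c : ℝ) (x : ℕ+ →₀ ℝ) :
    tsirelsonNorm M θ (c • x) = |c| * tsirelsonNorm M θ x := by
  simp only [tsirelsonNorm, normIter_smul]
  rw [Real.mul_iSup_of_nonneg (abs_nonneg c)]

theorem abs_le_tsirelsonNorm (hθ : ∀ k, θ k ∈ Set.Ioo (0 : ℝ) 1) (x : ℕ+ →₀ ℝ) (i : ℕ+) :
    |x i| ≤ tsirelsonNorm M θ x := (abs_le_supNorm x i).trans (normIter_le hθ 0 x)

theorem restrict_eq_self {E : Finset ℕ+} {x : ℕ+ →₀ ℝ} (h : x.support ⊆ E) : restrict E x = x :=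
  Finsupp.filter_eq_self_iff _ _ |>.2 fun _ hi => h (Finsupp.mem_support_iff.2 hi)

theorem restrict_eq_zero {E : Finset ℕ+} {x : ℕ+ →₀ ℝ} (h : ∀ i ∈ x.support, i ∉ E) :
    restrict E x = 0 :=
  Finsupp.filter_eq_zero_iff _ _ |>.2 fun i hi => by
    by_contra h0
    exact h i (Finsupp.mem_support_iff.2 h0) hi

/-- Uniqueness in the implicit equation (stated with the suprema as genuine upper bounds). -/
theorem tsirelsonNorm_unique (hθ : ∀ k, θ k ∈ Set.Ioo (0 : ℝ) 1) {c : ℝ} (hc : c < 1)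
    (hθc : ∀ k, θ k ≤ c) (hN0 : N 0 = 0) (hN : ∀ x, 0 ≤ N x)
    (hbdd : ∀ x, BddAbove (admissibleSums M θ N x)) (heq : ∀ x, N x = step M θ N x) :
    N = tsirelsonNorm M θ := by
  have hlow : ∀ m x, normIter M θ m x ≤ N x := by
    intro m
    induction m with
    | zero => intro x; rw [heq]; exact le_max_left _ _
    | succ m ih =>
      intro x
      rw [heq x]
      refine step_le (le_max_left _ _) fun k d E hE => ?_
      exact (mul_le_mul_of_nonneg_left (Finset.sum_le_sum fun i _ => ih _) (hθ k).1.le).trans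
        (le_max_of_le_right (le_csSup (hbdd x) ⟨k, d, E, hE, rfl⟩))
  have hup : ∀ (s : ℕ) (x : ℕ+ →₀ ℝ), x.support.card = s → N x ≤ tsirelsonNorm M θ x := by
    intro s
    induction s using Nat.strong_induction_on with
    | _ s ih =>
      intro x hx
      by_contra! hlt
      have hmax : N x ≤ max (tsirelsonNorm M θ x) (c * N x) := by
        conv_lhs => rw [heq x]
        refine step_le (le_max_of_le_left (normIter_le hθ 0 x)) fun k d E hE => ?_
        by_cases h : ∃ i, x.support ⊆ E i
        · obtain ⟨i, hi⟩ := h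
          refine le_max_of_le_right ?_
          rw [Finset.sum_eq_single i]
          · rw [restrict_eq_self hi]
            exact mul_le_mul_of_nonneg_right (hθc k) (hN x)
          · intro j _ hj
            rw [restrict_eq_zero, hN0]
            intro a ha haj
            rcases lt_or_gt_of_ne hj with h | h
            · exact lt_irrefl a (hE.1 _ _ h a haj a (hi ha))
            · exact lt_irrefl a (hE.1 _ _ h a (hi ha) a haj)
          · simp
        · refine le_max_of_le_left ?_
          push Not at h
          rw [tsirelsonNorm_eq hθ x]
          refine le_trans ?_ (le_step hθ (tsirelsonNorm_bounds hθ) x hE)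
          refine mul_le_mul_of_nonneg_left (Finset.sum_le_sum fun i _ => ?_) (hθ k).1.le
          refine ih _ ?_ _ rfl
          rw [← hx, restrict, Finsupp.support_filter]
          refine Finset.card_lt_card (Finset.filter_ssubset.2 ?_)
          obtain ⟨a, ha, hb⟩ := Finset.not_subset.1 (h i)
          exact ⟨a, ha, hb⟩
      have hpos : 0 < N x := (tsirelsonNorm_bounds hθ x).1.trans_lt hlt
      rcases le_max_iff.1 hmax with h | h
      · exact absurd h (not_le.2 hlt)
      · nlinarith
  funext x
  exact le_antisymm (hup _ x rfl) (ciSup_le fun m => hlow m x)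

end Facts

/-- `c₀₀` regarded as a normed space under the mixed Tsirelson norm. -/
def PreSpace (_M : ℕ+ → Set (Finset ℕ+)) (_θ : ℕ+ → ℝ)
    (_hθ : ∀ k, _θ k ∈ Set.Ioo (0 : ℝ) 1) : Type := ℕ+ →₀ ℝ

section Space

variable (M : ℕ+ → Set (Finset ℕ+)) (θ : ℕ+ → ℝ) (hθ : ∀ k, θ k ∈ Set.Ioo (0 : ℝ) 1)

instance : AddCommGroup (PreSpace M θ hθ) := inferInstanceAs (AddCommGroup (ℕ+ →₀ ℝ))

instance : Module ℝ (PreSpace M θ hθ) := inferInstanceAs (Module ℝ (ℕ+ →₀ ℝ))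

instance : Norm (PreSpace M θ hθ) := ⟨fun x => tsirelsonNorm M θ x⟩

theorem preSpace_core :
    NormedSpace.Core ℝ (PreSpace M θ hθ) where
  norm_nonneg x := (tsirelsonNorm_bounds hθ x).1
  norm_smul c x := tsirelsonNorm_smul c x
  norm_triangle x y := tsirelsonNorm_add_le hθ x y
  norm_eq_zero_iff x := by
    constructor
    · intro h
      refine Finsupp.ext fun i => abs_nonpos_iff.1 ?_
      exact (abs_le_tsirelsonNorm (M := M) hθ x i).trans h.le
    · rintro rfl
      have := tsirelsonNorm_smul (M := M) (θ := θ) 0 0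
      rw [zero_smul, abs_zero, zero_mul] at this
      exact this

instance : NormedAddCommGroup (PreSpace M θ hθ) :=
  NormedAddCommGroup.ofCore (preSpace_core M θ hθ)

instance : NormedSpace ℝ (PreSpace M θ hθ) := NormedSpace.ofCore (preSpace_core M θ hθ)

/-- The mixed Tsirelson space `T[(𝓜_k, θ_k)_k]`: the completion of `c₀₀` under the mixed
Tsirelson norm. -/
abbrev Space : Type := UniformSpace.Completion (PreSpace M θ hθ)

variable {M θ hθ}

/-- The canonical embedding of `c₀₀` into `T[(𝓜_k, θ_k)_k]`. -/
def ofC00 (x : ℕ+ →₀ ℝ) : Space M θ hθ := ((show PreSpace M θ hθ from x) : Space M θ hθ)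

/-- The biorthogonal functional `e_i^*` on `c₀₀`. -/
def preCoord (i : ℕ+) : PreSpace M θ hθ →L[ℝ] ℝ :=
  LinearMap.mkContinuous (Finsupp.lapply i : (ℕ+ →₀ ℝ) →ₗ[ℝ] ℝ) 1 fun x => by
    rw [one_mul]
    exact abs_le_tsirelsonNorm (M := M) hθ x i

/-- The biorthogonal functional `e_i^*` on `T[(𝓜_k, θ_k)_k]`: the continuous extension
of `x ↦ x_i` from `c₀₀`. -/
def coord (i : ℕ+) : Space M θ hθ →L[ℝ] ℝ :=
  (preCoord i).extend (UniformSpace.Completion.toComplL : PreSpace M θ hθ →L[ℝ] Space M θ hθ)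

theorem coord_ofC00 (i : ℕ+) (x : ℕ+ →₀ ℝ) : coord i (ofC00 x : Space M θ hθ) = x i :=
  ContinuousLinearMap.extend_eq _ (UniformSpace.Completion.denseRange_coe)
    (UniformSpace.Completion.isUniformInducing_coe _) _

theorem norm_ofC00 (x : ℕ+ →₀ ℝ) : ‖(ofC00 x : Space M θ hθ)‖ = tsirelsonNorm M θ x :=
  UniformSpace.Completion.norm_coe (E := PreSpace M θ hθ) x

/-- The support of a vector of `T[(𝓜_k, θ_k)_k]` with respect to the natural basis `(e_i)`. -/
def supp (y : Space M θ hθ) : Set ℕ+ := {i | coord i y ≠ 0}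

/-- An (infinite) block sequence: nonzero finitely supported vectors with `u₀ < u₁ < u₂ < ⋯`. -/
def IsBlockSequence (u : ℕ → ℕ+ →₀ ℝ) : Prop :=
  (∀ k, u k ≠ 0) ∧ ∀ k, Before (u k).support (u (k + 1)).support

/-- An infinite-dimensional block subspace: the closed linear span of an infinite block
sequence. -/
def IsBlockSubspace (Y : Submodule ℝ (Space M θ hθ)) : Prop :=
  ∃ u : ℕ → ℕ+ →₀ ℝ, IsBlockSequence u ∧
    Y = (Submodule.span ℝ (Set.range fun k => (ofC00 (u k) : Space M θ hθ))).topologicalClosure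

/-- A block subspace is indeed infinite-dimensional. -/
theorem IsBlockSubspace.not_finiteDimensional {Y : Submodule ℝ (Space M θ hθ)}
    (hY : IsBlockSubspace Y) : ¬ FiniteDimensional ℝ Y := by
  obtain ⟨u, ⟨hu0, hu⟩, rfl⟩ := hY
  have hlt : ∀ j k, j < k → Before (u j).support (u k).support := by
    intro j k hjk
    induction k, hjk using Nat.le_induction with
    | base => exact hu j
    | succ k _ ih =>
      intro a ha b hb
      obtain ⟨c, hc⟩ := Finsupp.support_nonempty_iff.2 (hu0 k)
      exact (ih a ha c hc).trans (hu k c hc b hb)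
  intro hfin
  have hli : LinearIndependent ℝ fun k => (ofC00 (u k) : Space M θ hθ) := by
    rw [linearIndependent_iff']
    intro s g hg k hk
    obtain ⟨i, hi⟩ := Finsupp.support_nonempty_iff.2 (hu0 k)
    have h := congrArg (coord i) hg
    rw [map_sum, map_zero, Finset.sum_eq_single k] at h
    · rw [map_smul, coord_ofC00, smul_eq_mul] at h
      exact (mul_eq_zero.1 h).resolve_right (Finsupp.mem_support_iff.1 hi)
    · intro j _ hj
      rw [map_smul, coord_ofC00, Finsupp.notMem_support_iff.1, smul_zero]
      intro hij
      rcases lt_or_gt_of_ne hj with h' | h'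
      · exact lt_irrefl i (hlt j k h' i hij i hi)
      · exact lt_irrefl i (hlt k j h' i hi i hij)
    · exact fun h' => absurd hk h'
  let v : ℕ → (Submodule.span ℝ
      (Set.range fun k => (ofC00 (u k) : Space M θ hθ))).topologicalClosure := fun k =>
    ⟨ofC00 (u k), Submodule.le_topologicalClosure _ (Submodule.subset_span ⟨k, rfl⟩)⟩
  have hv : LinearIndependent ℝ v := LinearIndependent.of_comp (Submodule.subtype _) hli
  exact not_finite_iff_infinite.2 (inferInstance : Infinite ℕ) hv.finite

end Space

/-- Finite sequences `(y_i)` and `(f_i)` in normed spaces are `C`-equivalent if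
`A⁻¹ ‖∑ a_i f_i‖ ≤ ‖∑ a_i y_i‖ ≤ B ‖∑ a_i f_i‖` for all scalars, for some `A, B > 0`
with `A B ≤ C`. -/
def IsEquivalentSeq {E F : Type*} [NormedAddCommGroup E] [NormedSpace ℝ E]
    [NormedAddCommGroup F] [NormedSpace ℝ F] (C : ℝ) {n : ℕ} (y : Fin n → E) (f : Fin n → F) :
    Prop :=
  ∃ A B : ℝ, 0 < A ∧ 0 < B ∧ A * B ≤ C ∧ ∀ a : Fin n → ℝ,
    A⁻¹ * ‖∑ i, a i • f i‖ ≤ ‖∑ i, a i • y i‖ ∧ ‖∑ i, a i • y i‖ ≤ B * ‖∑ i, a i • f i‖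

/-- A sequence `(θ_n)_{n ≥ 1}` is regular if `θ_n ∈ (0, 1)`, `θ_n ↓ 0` and
`θ_{n+m} ≥ θ_n θ_m`. -/
structure IsRegularSeq (θ : ℕ+ → ℝ) : Prop where
  mem_Ioo : ∀ n, θ n ∈ Set.Ioo (0 : ℝ) 1
  antitone : Antitone θ
  tendsto_zero : Tendsto θ atTop (𝓝 0)
  mul_le : ∀ n m, θ n * θ m ≤ θ (n + m)

end MixedTsirelson

end

namespace MixedTsirelson

/-! ### Schreier families -/

/-! The norm is a lattice norm, so disjoint vectors of norm at least 1 dominate the maximum of their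
coefficients, and the norm of their plain sum controls all combinations from above. A James-type
blocking argument (`exists_disjoint_nrm_sum_le_one_add`) reduces the bound 1+ε for that sum to any
bound independent of the number of vectors. The bound 9 is what the construction gives.

The limit condition says that the weights do not decay geometrically. It enters twice. First
(`exists_flat`), every tail contains vectors of norm at least 1 that are flat of any prescribed
order j with constant 4. Otherwise repeated averaging would halve the norm at each step, while a
lower ℓ₁ estimate persists at a cost of j+1 orders per step, and the weights would be geometrically
small. Second (`exists_weight_le_two_mul`), there are arbitrarily large orders after which the
weights lose at most a factor 2 over a prescribed number of further orders.

The disjoint vectors are built by induction on their number (`Representable.succ`). Blocks v_k/w +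
z_k are averaged. Here z_k is a sum of the vectors already constructed, v_k is flat of rapidly
increasing order, and w is about the weight of the order of the averaging. Averaging then brings the
v-part down to norm about 1, while the sum must stay bounded by max(8, C) up to ε, instead of 8 + C.
This works because a norming functional can be cut at order p+1 (`Norming.frontier`) into pieces,
and up to a small error each block is met by only one piece (`sum_average_le`). A piece of small
weight order r gains the accumulated factor θ_{p+1} on both summands: this kills z_k and leaves at
most 8 from v_k/w. A piece of large order r sees at most C on z_k and is negligible on v_k, unless r
lies between the orders of v_k and v_{k+1}. As these ranges are disjoint, each piece has at most one
such exceptional block, and the exceptional blocks carry little mass of the average. -/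

theorem empty_mem_schreier (n : ℕ) : (∅ : Finset ℕ+) ∈ schreier n := by
  cases n with
  | zero => exact Or.inl rfl
  | succ n => exact ⟨0, Fin.elim0, fun i => i.elim0, fun i => i.elim0, fun i => i.elim0, by simp⟩

theorem schreier_subset_succ (n : ℕ) : schreier n ⊆ schreier (n + 1) := fun A hA =>
  ⟨1, fun _ => A, fun _ => hA, fun i j h => absurd h (by simp [Subsingleton.elim i j]),
    fun _ a _ => a.pos, by simp⟩

theorem schreier_mono : Monotone schreier := monotone_nat_of_le_succ schreier_subset_succ

theorem singleton_mem_schreier (n : ℕ) (a : ℕ+) : {a} ∈ schreier n :=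
  schreier_mono (Nat.zero_le n) (Or.inr ⟨a, rfl⟩)

/-- The Schreier families are hereditary and spreading. -/
theorem schreier_spread {n : ℕ} {A B : Finset ℕ+} {φ : ℕ+ → ℕ+} (hA : A ∈ schreier n)
    (hφ : ∀ b ∈ B, φ b ∈ A) (hmono : StrictMonoOn φ B) (hle : ∀ b ∈ B, φ b ≤ b) :
    B ∈ schreier n := by
  induction n generalizing A B with
  | zero =>
    have hsub : ∀ b ∈ B, ∀ c ∈ B, b = c := by
      intro b hb c hc
      refine hmono.injOn hb hc ?_
      rcases hA with rfl | ⟨a, rfl⟩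
      · exact absurd (hφ b hb) (by simp)
      · rw [Finset.mem_singleton.1 (hφ b hb), Finset.mem_singleton.1 (hφ c hc)]
    rcases B.eq_empty_or_nonempty with h | ⟨b, hb⟩
    · exact Or.inl h
    · exact Or.inr ⟨b, Finset.eq_singleton_iff_unique_mem.2 ⟨hb, fun c hc => hsub c hc b hb⟩⟩
  | succ n ih =>
    obtain ⟨d, S, hS, hsucc, hd, rfl⟩ := hA
    refine ⟨d, fun i => B.filter (φ · ∈ S i), fun i => ?_, fun i j hij a ha b hb => ?_,
      fun i a ha => ?_, ?_⟩
    · refine ih (hS i) (fun b hb => (Finset.mem_filter.1 hb).2) (hmono.mono ?_)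
        fun b hb => hle b (Finset.mem_filter.1 hb).1
      intro b hb
      exact (Finset.mem_filter.1 hb).1
    · obtain ⟨ha, ha'⟩ := Finset.mem_filter.1 ha
      obtain ⟨hb, hb'⟩ := Finset.mem_filter.1 hb
      exact (hmono.lt_iff_lt ha hb).1 (hsucc i j hij _ ha' _ hb')
    · obtain ⟨ha, ha'⟩ := Finset.mem_filter.1 ha
      exact (hd i _ ha').trans (PNat.coe_le_coe _ _ |>.2 (hle a ha))
    · ext b
      simp only [Finset.mem_biUnion, Finset.mem_univ, true_and, Finset.mem_filter]
      constructor
      · intro hb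
        obtain ⟨i, -, hi⟩ := Finset.mem_biUnion.1 (hφ b hb)
        exact ⟨i, hb, hi⟩
      · rintro ⟨i, hb, -⟩
        exact hb

theorem schreier_subset {n : ℕ} {A B : Finset ℕ+} (hA : A ∈ schreier n) (h : B ⊆ A) :
    B ∈ schreier n :=
  schreier_spread (φ := id) hA (fun _ hb => h hb) (strictMono_id.strictMonoOn _) fun _ _ => le_rfl

/-- Composition of Schreier families: `𝓕_k[𝓕_l] ⊆ 𝓕_{l+k}`. -/
theorem schreier_comp {ι : Type*} [DecidableEq ι] {l k : ℕ} {s : Finset ι} {t : ι → ℕ+}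
    {B : ι → Finset ℕ+} (hs : s.image t ∈ schreier k) (hB : ∀ i ∈ s, B i ∈ schreier l)
    (hle : ∀ i ∈ s, ∀ b ∈ B i, t i ≤ b)
    (hlt : ∀ i ∈ s, ∀ j ∈ s, t i < t j → Before (B i) (B j)) (hinj : Set.InjOn t s) :
    s.biUnion B ∈ schreier (l + k) := by
  induction k generalizing s with
  | zero =>
    rcases hs with h | ⟨a, h⟩
    · rw [Finset.image_eq_empty.1 h]
      simpa using empty_mem_schreier l
    · rcases s.eq_empty_or_nonempty with rfl | ⟨i, hi⟩
      · simp at h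
      · have : s = {i} := Finset.eq_singleton_iff_unique_mem.2 ⟨hi, fun j hj => hinj hj hi <| by
          have hm : ∀ r ∈ s, t r = a := fun r hr =>
            Finset.mem_singleton.1 (h ▸ Finset.mem_image_of_mem t hr)
          rw [hm i hi, hm j hj]⟩
        subst this
        simpa using hB i hi
  | succ k ih =>
    obtain ⟨d, S, hS, hsucc, hd, hsS⟩ := hs
    -- Indices are grouped by the set `S r` that contains their marker `t i`; the bound `d` survives
    -- because each `B i` lies beyond `t i`.
    refine ⟨d, fun r => (s.filter (t · ∈ S r)).biUnion B, fun r => ?_, ?_, ?_, ?_⟩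
    · have e : (s.filter (t · ∈ S r)).image t = S r := by
        ext a
        simp only [Finset.mem_image, Finset.mem_filter]
        constructor
        · rintro ⟨i, ⟨-, hi⟩, rfl⟩
          exact hi
        · intro ha
          have : a ∈ s.image t := hsS ▸ Finset.mem_biUnion.2 ⟨r, Finset.mem_univ _, ha⟩
          obtain ⟨i, hi, rfl⟩ := Finset.mem_image.1 this
          exact ⟨i, ⟨hi, ha⟩, rfl⟩
      refine ih (by rw [e]; exact hS r) (fun i hi => hB i (Finset.mem_filter.1 hi).1)
        (fun i hi => hle i (Finset.mem_filter.1 hi).1)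
        (fun i hi j hj => hlt i (Finset.mem_filter.1 hi).1 j (Finset.mem_filter.1 hj).1)
        (hinj.mono fun i hi => (Finset.mem_filter.1 hi).1)
    · intro r r' hr a ha b hb
      obtain ⟨i, hi, ha⟩ := Finset.mem_biUnion.1 ha
      obtain ⟨j, hj, hb⟩ := Finset.mem_biUnion.1 hb
      obtain ⟨hi, hi'⟩ := Finset.mem_filter.1 hi
      obtain ⟨hj, hj'⟩ := Finset.mem_filter.1 hj
      exact hlt i hi j hj (hsucc r r' hr _ hi' _ hj') a ha b hb
    · intro r a ha
      obtain ⟨i, hi, ha⟩ := Finset.mem_biUnion.1 ha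
      obtain ⟨hi, hi'⟩ := Finset.mem_filter.1 hi
      exact (hd r _ hi').trans (PNat.coe_le_coe _ _ |>.2 (hle i hi a ha))
    · ext b
      simp only [Finset.mem_biUnion, Finset.mem_univ, true_and, Finset.mem_filter]
      constructor
      · rintro ⟨i, hi, hb⟩
        have : t i ∈ Finset.univ.biUnion S := hsS ▸ Finset.mem_image_of_mem t hi
        obtain ⟨r, -, hr⟩ := Finset.mem_biUnion.1 this
        exact ⟨r, i, ⟨hi, hr⟩, hb⟩
      · rintro ⟨r, i, ⟨hi, -⟩, hb⟩
        exact ⟨i, hi, hb⟩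

/-! ### Unordered admissible families -/

/-- The minimum of a nonempty finite set of positive integers. -/
def minElt (E : Finset ℕ+) : ℕ+ := if h : E.Nonempty then E.min' h else 1

theorem minElt_eq {E : Finset ℕ+} (h : E.Nonempty) : minElt E = E.min' h := dif_pos h

theorem minElt_mem {E : Finset ℕ+} (h : E.Nonempty) : minElt E ∈ E := by
  rw [minElt_eq h]
  exact E.min'_mem h

theorem minElt_le {E : Finset ℕ+} {a : ℕ+} (h : a ∈ E) : minElt E ≤ a := by
  rw [minElt_eq ⟨a, h⟩]
  exact E.min'_le a h

/-- A family indexed by a finite type is `𝓕_n`-admissible if it is so after rearrangement. -/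
structure AdmFam (n : ℕ) {ι : Type} [Fintype ι] (F : ι → Finset ℕ+) : Prop where
  nonempty : ∀ i, (F i).Nonempty
  sep : ∀ i j, i ≠ j → Before (F i) (F j) ∨ Before (F j) (F i)
  mem : Finset.univ.image (fun i => minElt (F i)) ∈ schreier n

namespace AdmFam

variable {n : ℕ} {ι : Type} [Fintype ι] {F : ι → Finset ℕ+}

theorem of_admissible {d : ℕ} {E : Fin d → Finset ℕ+} (h : Admissible (schreier n) E) :
    AdmFam n E := by
  obtain ⟨hs, hne, hm⟩ := h
  refine ⟨hne, fun i j hij => ?_, ?_⟩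
  · rcases lt_or_gt_of_ne hij with h | h
    · exact Or.inl (hs i j h)
    · exact Or.inr (hs j i h)
  · convert hm using 3 with i
    exact minElt_eq (hne i)

theorem injective (h : AdmFam n F) : Function.Injective fun i => minElt (F i) := by
  intro i j hij
  by_contra hne
  have hi := minElt_mem (h.nonempty i)
  have hj := minElt_mem (h.nonempty j)
  simp only at hij
  rcases h.sep i j hne with h | h
  · exact absurd (h _ hi _ hj) (by rw [hij]; exact lt_irrefl _)
  · exact absurd (h _ hj _ hi) (by rw [hij]; exact lt_irrefl _)

theorem before_of_lt (h : AdmFam n F) {i j : ι} (hij : minElt (F i) < minElt (F j)) :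
    Before (F i) (F j) := by
  rcases h.sep i j (fun e => by simp [e] at hij) with h' | h'
  · exact h'
  · exact absurd (h' _ (minElt_mem (h.nonempty j)) _ (minElt_mem (h.nonempty i))) hij.not_gt

theorem mono {m : ℕ} (h : AdmFam n F) (hnm : n ≤ m) : AdmFam m F :=
  ⟨h.nonempty, h.sep, schreier_mono hnm h.mem⟩

theorem of_subsingleton [Subsingleton ι] (h : ∀ i, (F i).Nonempty) : AdmFam n F := by
  refine ⟨h, fun i j hij => absurd (Subsingleton.elim i j) hij, ?_⟩
  rcases isEmpty_or_nonempty ι with hι | ⟨⟨i⟩⟩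
  · simpa using empty_mem_schreier n
  · have : (Finset.univ : Finset ι) = {i} := by
      ext j
      simp [Subsingleton.elim j i]
    rw [this, Finset.image_singleton]
    exact singleton_mem_schreier _ _

/-- An admissible family can be listed in increasing order. -/
theorem exists_equiv (h : AdmFam n F) :
    ∃ (d : ℕ) (e : Fin d ≃ ι), Admissible (schreier n) fun i => F (e i) := by
  classical
  let S := Finset.univ.image fun i => minElt (F i)
  let e₁ : ι ≃ S := Equiv.ofBijective
    (fun i => ⟨minElt (F i), Finset.mem_image_of_mem _ (Finset.mem_univ i)⟩)
    ⟨fun i j hij => h.injective (congrArg Subtype.val hij), fun ⟨a, ha⟩ => by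
      obtain ⟨i, -, hi⟩ := Finset.mem_image.1 ha
      exact ⟨i, Subtype.ext hi⟩⟩
  let e₂ := S.orderIsoOfFin rfl
  have key : ∀ r, minElt (F (e₁.symm (e₂ r))) = e₂ r := fun r =>
    congrArg Subtype.val (e₁.apply_symm_apply (e₂ r))
  refine ⟨S.card, e₂.toEquiv.trans e₁.symm, fun i j hij => ?_, fun i => h.nonempty _, ?_⟩
  · refine h.before_of_lt ?_
    change minElt (F (e₁.symm (e₂ i))) < minElt (F (e₁.symm (e₂ j)))
    rw [key, key]
    exact_mod_cast e₂.strictMono hij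
  · convert h.mem using 1
    ext a
    simp only [Finset.mem_image, Finset.mem_univ, true_and, ← minElt_eq (h.nonempty _)]
    constructor
    · rintro ⟨i, rfl⟩
      exact ⟨_, rfl⟩
    · rintro ⟨i, rfl⟩
      exact ⟨(e₂.toEquiv.trans e₁.symm).symm i, by rw [Equiv.apply_symm_apply]⟩

/-- Passing to nonempty subsets of a subfamily preserves admissibility. -/
theorem comp_subset (h : AdmFam n F) {κ : Type} [Fintype κ] {H : κ → Finset ℕ+} {e : κ → ι}
    (he : Function.Injective e) (hne : ∀ j, (H j).Nonempty) (hsub : ∀ j, H j ⊆ F (e j)) :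
    AdmFam n H := by
  classical
  have hinj : Function.Injective fun j => minElt (H j) := by
    intro i j hij
    by_contra hne'
    have hi := hsub i (minElt_mem (hne i))
    have hj := hsub j (minElt_mem (hne j))
    simp only at hij
    rcases h.sep (e i) (e j) (he.ne hne') with h | h
    · exact absurd (h _ hi _ hj) (by rw [hij]; exact lt_irrefl _)
    · exact absurd (h _ hj _ hi) (by rw [hij]; exact lt_irrefl _)
  refine ⟨hne, fun i j hij => ?_, ?_⟩
  · rcases h.sep (e i) (e j) (he.ne hij) with h' | h'
    · exact Or.inl fun a ha b hb => h' a (hsub i ha) b (hsub j hb)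
    · exact Or.inr fun a ha b hb => h' a (hsub j ha) b (hsub i hb)
  · rcases isEmpty_or_nonempty κ with hκ | hκ
    · simpa using empty_mem_schreier n
    let inv := Function.invFun fun j => minElt (H j)
    have hinv : ∀ j, inv (minElt (H j)) = j := Function.leftInverse_invFun hinj
    refine schreier_spread (φ := fun a => minElt (F (e (inv a)))) h.mem ?_ ?_ ?_
    · intro b hb
      exact Finset.mem_image_of_mem _ (Finset.mem_univ _)
    · intro b hb c hc hbc
      obtain ⟨i, -, rfl⟩ := Finset.mem_image.1 hb
      obtain ⟨j, -, rfl⟩ := Finset.mem_image.1 hc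
      simp only [hinv]
      by_contra hcon
      rcases (not_lt.1 hcon).eq_or_lt with h' | h'
      · have := he (h.injective h')
        simp [this] at hbc
      · exact absurd hbc (h.before_of_lt h' _ (hsub j (minElt_mem (hne j))) _
          (hsub i (minElt_mem (hne i)))).not_gt
    · intro b hb
      obtain ⟨i, -, rfl⟩ := Finset.mem_image.1 hb
      simp only [hinv]
      exact minElt_le (hsub i (minElt_mem (hne i)))

/-- Orders add under refinement: the minima of the pieces of `F i` lie beyond `minElt (F i)`, so
`schreier_comp` applies. Indexing by arbitrary finite types makes the refined family a plain sigma
type, with no sorting. -/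
theorem sigma (h : AdmFam n F) {l : ℕ} {κ : ι → Type} [∀ i, Fintype (κ i)]
    {H : ∀ i, κ i → Finset ℕ+} (hH : ∀ i, AdmFam l (H i)) (hsub : ∀ i j, H i j ⊆ F i) :
    AdmFam (l + n) fun p : Σ i, κ i => H p.1 p.2 := by
  classical
  refine ⟨fun p => (hH p.1).nonempty p.2, fun p p' hp => ?_, ?_⟩
  · obtain ⟨i, a⟩ := p
    obtain ⟨j, b⟩ := p'
    by_cases hij : i = j
    · subst hij
      exact (hH i).sep a b fun hab => hp (by rw [hab])
    · rcases h.sep i j hij with h' | h'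
      · exact Or.inl fun x hx y hy => h' x (hsub i a hx) y (hsub j b hy)
      · exact Or.inr fun x hx y hy => h' x (hsub j b hx) y (hsub i a hy)
  · have hsub' : ∀ i, ∀ b ∈ Finset.univ.image (fun j => minElt (H i j)), b ∈ F i := by
      intro i b hb
      obtain ⟨j, -, rfl⟩ := Finset.mem_image.1 hb
      exact hsub i j (minElt_mem ((hH i).nonempty j))
    have := schreier_comp (l := l) (B := fun i => Finset.univ.image fun j => minElt (H i j)) h.mem
      (fun i _ => (hH i).mem) (fun i _ b hb => minElt_le (hsub' i b hb))
      (fun i _ j _ hij a ha b hb => h.before_of_lt hij a (hsub' i a ha) b (hsub' j b hb))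
      h.injective.injOn
    convert this using 1
    ext a
    simp

end AdmFam

/-! ### Special convex combinations -/

/-- Special convex combinations along a sequence of intervals `[lo k, hi k]`: convex weights on a
set of `𝓕_{p+1}`-admissible intervals that are small on each `𝓕_p`-set. -/
theorem exists_average_zero {lo hi : ℕ → ℕ+} (h₁ : ∀ k, lo k ≤ hi k)
    (h₂ : ∀ k, hi k < lo (k + 1)) {δ : ℝ} (hδ : 0 < δ) (K : ℕ) :
    ∃ (G : Finset ℕ) (a : ℕ → ℝ), (∀ k ∈ G, K ≤ k ∧ 0 < a k) ∧ ∑ k ∈ G, a k = 1 ∧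
      G.image lo ∈ schreier 1 ∧
      ∀ A ⊆ G, A.image hi ∈ schreier 0 → ∑ k ∈ A, a k ≤ δ := by
  have hhi : StrictMono hi := strictMono_nat_of_lt_succ fun k => (h₂ k).trans_le (h₁ _)
  have hlo : StrictMono lo := strictMono_nat_of_lt_succ fun k => (h₁ k).trans_lt (h₂ _)
  obtain ⟨D, hD⟩ := exists_nat_gt (1 / δ)
  have hD0 : (0 : ℝ) < D := (one_div_pos.2 hδ).trans hD
  have hDδ : 1 / (D : ℝ) ≤ δ := by
    rw [div_le_iff₀ hD0]
    rw [div_lt_iff₀ hδ] at hD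
    linarith
  -- Equal weights on `D` intervals; starting no earlier than index `D` puts all left endpoints at
  -- or beyond `D`.
  refine ⟨Finset.Ico (max K D) (max K D + D), fun _ => 1 / D, fun k hk => ⟨?_, by positivity⟩,
    ?_, ?_, ?_⟩
  · exact (le_max_left _ _).trans (Finset.mem_Ico.1 hk).1
  · simp [hD0.ne']
  · refine ⟨D, fun i => {lo (max K D + i)}, fun i => Or.inr ⟨_, rfl⟩, fun i j hij a ha b hb => ?_,
      fun i a ha => ?_, ?_⟩
    · rw [Finset.mem_singleton.1 ha, Finset.mem_singleton.1 hb]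
      exact hlo (by simpa using hij)
    · rw [Finset.mem_singleton.1 ha]
      have : ∀ k, k ≤ (lo k : ℕ) := by
        intro k
        induction k with
        | zero => exact Nat.zero_le _
        | succ k ih => exact Nat.succ_le_of_lt (ih.trans_lt (hlo (Nat.lt_succ_self k)))
      exact le_trans (by omega) (this _)
    · ext a
      simp only [Finset.mem_image, Finset.mem_Ico, Finset.mem_biUnion, Finset.mem_univ, true_and,
        Finset.mem_singleton]
      constructor
      · rintro ⟨k, hk, rfl⟩
        exact ⟨⟨k - max K D, by omega⟩, by simp only; congr 1; omega⟩
      · rintro ⟨i, rfl⟩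
        exact ⟨_, ⟨by omega, by have := i.2; omega⟩, rfl⟩
  · intro A _ hA
    rw [Finset.sum_const, nsmul_eq_mul]
    have : A.card ≤ 1 := by
      rw [← Finset.card_image_of_injective A hhi.injective]
      rcases hA with h | ⟨a, h⟩ <;> simp [h]
    calc (A.card : ℝ) * (1 / D) ≤ 1 * (1 / D) := by
          gcongr
          exact_mod_cast this
      _ ≤ δ := by rwa [one_mul]

/-- Average `D` successive averages of order `p`, each chosen small relative to where the previous
ones end. A set of the next Schreier family that meets an early average splits into few sets of
order `p`, so it captures almost nothing of the later averages. Left endpoints are used for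
membership and right endpoints for smallness: since the families are spreading, both are the
stronger choice. -/
theorem exists_average {lo hi : ℕ → ℕ+} (h₁ : ∀ k, lo k ≤ hi k)
    (h₂ : ∀ k, hi k < lo (k + 1)) (p : ℕ) {δ : ℝ} (hδ : 0 < δ) (K : ℕ) :
    ∃ (G : Finset ℕ) (a : ℕ → ℝ), (∀ k ∈ G, K ≤ k ∧ 0 < a k) ∧ ∑ k ∈ G, a k = 1 ∧
      G.image lo ∈ schreier (p + 1) ∧
      ∀ A ⊆ G, A.image hi ∈ schreier p → ∑ k ∈ A, a k ≤ δ := by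
  have hhi : StrictMono hi := strictMono_nat_of_lt_succ fun k => (h₂ k).trans_le (h₁ _)
  have hlo : StrictMono lo := strictMono_nat_of_lt_succ fun k => (h₁ k).trans_lt (h₂ _)
  induction p generalizing δ K with
  | zero => exact exists_average_zero h₁ h₂ hδ K
  | succ p ih =>
    -- Unnormalised version with total mass `D`: only the first average met can contribute as much
    -- as 1, and each later one contributes at most `ε`.
    have inner : ∀ {ε : ℝ}, 0 < ε → ∀ K D : ℕ, ∃ (G : Finset ℕ) (a : ℕ → ℝ),
        (∀ k ∈ G, K ≤ k ∧ 0 < a k) ∧ ∑ k ∈ G, a k = D ∧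
        (∃ B : Fin D → Finset ℕ+, (∀ i, B i ∈ schreier (p + 1)) ∧ Successive B ∧
          G.image lo = Finset.univ.biUnion B) ∧
        ∀ A ⊆ G, A.image hi ∈ schreier (p + 1) → ∑ k ∈ A, a k ≤ 1 + D * ε := by
      intro ε hε K D
      induction D with
      | zero =>
        refine ⟨∅, 0, by simp, by simp, ⟨Fin.elim0, fun i => i.elim0, fun i => i.elim0, by simp⟩, ?_⟩
        intro A hA _
        rw [Finset.subset_empty.1 hA]
        simp
      | succ D ihD =>
        obtain ⟨G, a, hG, hsum, ⟨B, hB, hBs, hGB⟩, hsmall⟩ := ihD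
        obtain ⟨K₂, hK₂⟩ : ∃ K₂, K ≤ K₂ ∧ ∀ k ∈ G, k < K₂ :=
          ⟨max K (G.sup id + 1), le_max_left _ _, fun k hk =>
            lt_max_of_lt_right (Nat.lt_succ_of_le (Finset.le_sup (f := id) hk))⟩
        have hpos : (0 : ℝ) < ((hi K₂ : ℕ) : ℝ) := by exact_mod_cast (hi K₂).pos
        -- A set meeting `G` consists of at most `hi K₂` pieces of order `p`, whence the tolerance
        -- `ε / hi K₂` per piece.
        obtain ⟨G', a', hG', hsum', hGS', hsmall'⟩ := ih (div_pos hε hpos) K₂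
        have hdisj : Disjoint G G' := Finset.disjoint_left.2 fun k hk hk' =>
          absurd (hK₂.2 k hk) (hG' k hk').1.not_gt
        have e₁ : ∀ A ⊆ G, ∑ k ∈ A, (if k ∈ G then a k else a' k) = ∑ k ∈ A, a k := fun A hA =>
          Finset.sum_congr rfl fun k hk => if_pos (hA hk)
        have e₂ : ∀ A ⊆ G', ∑ k ∈ A, (if k ∈ G then a k else a' k) = ∑ k ∈ A, a' k := fun A hA =>
          Finset.sum_congr rfl fun k hk => if_neg (Finset.disjoint_right.1 hdisj (hA hk))
        refine ⟨G ∪ G', fun k => if k ∈ G then a k else a' k, ?_, ?_,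
          ⟨Fin.snoc B (G'.image lo), ?_, ?_, ?_⟩, ?_⟩
        · intro k hk
          rcases Finset.mem_union.1 hk with h | h
          · simpa [h] using hG k h
          · simpa [Finset.disjoint_right.1 hdisj h] using
              ⟨hK₂.1.trans (hG' k h).1, (hG' k h).2⟩
        · rw [Finset.sum_union hdisj, e₁ G subset_rfl, e₂ G' subset_rfl, hsum, hsum']
          push_cast
          ring
        · intro i
          induction i using Fin.lastCases with
          | last => simpa using hGS'
          | cast i => simpa using hB i
        · intro i j hij
          induction j using Fin.lastCases with
          | last =>
            induction i using Fin.lastCases with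
            | last => exact absurd hij (lt_irrefl _)
            | cast i =>
              rw [Fin.snoc_castSucc, Fin.snoc_last]
              intro x hx y hy
              have : x ∈ G.image lo := hGB ▸ Finset.mem_biUnion.2 ⟨i, Finset.mem_univ _, hx⟩
              obtain ⟨k, hk, rfl⟩ := Finset.mem_image.1 this
              obtain ⟨k', hk', rfl⟩ := Finset.mem_image.1 hy
              exact hlo ((hK₂.2 k hk).trans_le (hG' k' hk').1)
          | cast j =>
            induction i using Fin.lastCases with
            | last => exact absurd hij (not_lt.2 (Fin.le_last _))
            | cast i =>
              rw [Fin.snoc_castSucc, Fin.snoc_castSucc]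
              exact hBs i j (by simpa using hij)
        · ext x
          rw [Finset.image_union, hGB]
          simp only [Finset.mem_union, Finset.mem_biUnion, Finset.mem_univ, true_and,
            Fin.exists_fin_succ', Fin.snoc_castSucc, Fin.snoc_last]
        · intro A hA hAS
          have hA' : A = A ∩ G ∪ A ∩ G' := by
            rw [← Finset.inter_union_distrib_left, Finset.inter_eq_left.2 hA]
          have hnn : (0 : ℝ) ≤ D * ε := by positivity
          rw [hA', Finset.sum_union (hdisj.mono Finset.inter_subset_right Finset.inter_subset_right),
            e₁ _ Finset.inter_subset_right, e₂ _ Finset.inter_subset_right]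
          have hcast : ((D + 1 : ℕ) : ℝ) * ε = D * ε + ε := by push_cast; ring
          rcases (A ∩ G).eq_empty_or_nonempty with hem | ⟨k₀, hk₀⟩
          · rw [hem, Finset.sum_empty, zero_add, hcast]
            have : ∑ k ∈ A ∩ G', a' k ≤ 1 := hsum' ▸ Finset.sum_le_sum_of_subset_of_nonneg
              Finset.inter_subset_right fun k hk _ => (hG' k hk).2.le
            linarith
          · have h1 := hsmall (A ∩ G) Finset.inter_subset_right
              (schreier_subset hAS (Finset.image_subset_image Finset.inter_subset_left))
            obtain ⟨d, S, hS, -, hd, hAS'⟩ := hAS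
            have hdle : (d : ℝ) ≤ ((hi K₂ : ℕ) : ℝ) := by
              have : hi k₀ ∈ Finset.univ.biUnion S :=
                hAS' ▸ Finset.mem_image_of_mem hi (Finset.mem_inter.1 hk₀).1
              obtain ⟨i, -, hi'⟩ := Finset.mem_biUnion.1 this
              have h := hd i _ hi'
              have h' : (hi k₀ : ℕ) ≤ (hi K₂ : ℕ) :=
                hhi.monotone (hK₂.2 k₀ (Finset.mem_inter.1 hk₀).2).le
              exact_mod_cast h.trans h'
            have h2 : ∑ k ∈ A ∩ G', a' k ≤ ε := by
              have hsub : ∀ i, (A ∩ G').filter (hi · ∈ S i) ⊆ G' := fun i =>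
                (Finset.filter_subset _ _).trans Finset.inter_subset_right
              calc ∑ k ∈ A ∩ G', a' k
                  ≤ ∑ k ∈ A ∩ G', ∑ i, if hi k ∈ S i then a' k else 0 := by
                    refine Finset.sum_le_sum fun k hk => ?_
                    have hk0 := (hG' k (Finset.mem_inter.1 hk).2).2.le
                    have : hi k ∈ Finset.univ.biUnion S :=
                      hAS' ▸ Finset.mem_image_of_mem hi (Finset.mem_inter.1 hk).1
                    obtain ⟨i, -, hi'⟩ := Finset.mem_biUnion.1 this
                    have h := Finset.single_le_sum (f := fun i => if hi k ∈ S i then a' k else 0)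
                      (fun i _ => by split_ifs <;> simp [hk0]) (Finset.mem_univ i)
                    rwa [if_pos hi'] at h
                _ = ∑ i, ∑ k ∈ (A ∩ G').filter (hi · ∈ S i), a' k := by
                    rw [Finset.sum_comm]
                    simp only [Finset.sum_filter]
                _ ≤ ∑ _i : Fin d, ε / ((hi K₂ : ℕ) : ℝ) := by
                    refine Finset.sum_le_sum fun i _ => hsmall' _ (hsub i) ?_
                    refine schreier_subset (hS i) fun x hx => ?_
                    obtain ⟨k, hk, rfl⟩ := Finset.mem_image.1 hx
                    exact (Finset.mem_filter.1 hk).2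
                _ = d * (ε / ((hi K₂ : ℕ) : ℝ)) := by simp
                _ ≤ (hi K₂ : ℕ) * (ε / ((hi K₂ : ℕ) : ℝ)) := by gcongr
                _ = ε := by field_simp
            rw [hcast]
            linarith
    obtain ⟨D, hD⟩ := exists_nat_gt (2 / δ)
    have hD0 : (0 : ℝ) < D := (div_pos two_pos hδ).trans hD
    have hDδ : 1 / (D : ℝ) ≤ δ / 2 := by
      rw [div_lt_iff₀ hδ] at hD
      rw [div_le_iff₀ hD0]
      linarith
    obtain ⟨G, a, hG, hsum, ⟨B, hB, hBs, hGB⟩, hsmall⟩ := inner (half_pos hδ) (max K D) D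
    refine ⟨G, fun k => a k / D, fun k hk => ⟨(le_max_left _ _).trans (hG k hk).1,
      div_pos (hG k hk).2 hD0⟩, ?_, ⟨D, B, hB, hBs, ?_, hGB⟩, ?_⟩
    · rw [← Finset.sum_div, hsum, div_self hD0.ne']
    · intro i x hx
      have : x ∈ G.image lo := hGB ▸ Finset.mem_biUnion.2 ⟨i, Finset.mem_univ _, hx⟩
      obtain ⟨k, hk, rfl⟩ := Finset.mem_image.1 this
      have : ∀ k, k ≤ (lo k : ℕ) := by
        intro k
        induction k with
        | zero => exact Nat.zero_le _
        | succ k ih => exact Nat.succ_le_of_lt (ih.trans_lt (hlo (Nat.lt_succ_self k)))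
      exact ((le_max_right _ _).trans (hG k hk).1).trans (this k)
    · intro A hA hAS
      rw [← Finset.sum_div, div_le_iff₀ hD0]
      have := hsmall A hA hAS
      rw [div_le_iff₀ hD0] at hDδ
      linarith

/-! ### The norm on `c₀₀` -/

theorem restrict_apply (E : Finset ℕ+) (x : ℕ+ →₀ ℝ) (i : ℕ+) :
    restrict E x i = if i ∈ E then x i else 0 := Finsupp.filter_apply _ _ _

theorem restrict_smul (E : Finset ℕ+) (c : ℝ) (x : ℕ+ →₀ ℝ) :
    restrict E (c • x) = c • restrict E x := Finsupp.filter_smul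

theorem restrict_sum {ι : Type*} (E : Finset ℕ+) (s : Finset ι) (x : ι → ℕ+ →₀ ℝ) :
    restrict E (∑ i ∈ s, x i) = ∑ i ∈ s, restrict E (x i) := by
  ext j
  simp only [restrict_apply, Finsupp.finsetSum_apply]
  split_ifs <;> simp

theorem support_restrict (E : Finset ℕ+) (x : ℕ+ →₀ ℝ) :
    (restrict E x).support = x.support ∩ E := by
  ext i
  simp only [Finsupp.mem_support_iff, restrict_apply, Finset.mem_inter]
  split_ifs with h <;> simp [h]

/-- The norm of the mixed Tsirelson space built on the Schreier families. -/
noncomputable abbrev nrm (θ : ℕ+ → ℝ) (x : ℕ+ →₀ ℝ) : ℝ := tsirelsonNorm (fun n : ℕ+ => schreier n) θ x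

/-- The weights `θ_n`, extended by `θ₀ = 1`. -/
noncomputable def weight (θ : ℕ+ → ℝ) (n : ℕ) : ℝ := if h : 0 < n then θ ⟨n, h⟩ else 1

theorem weight_coe (θ : ℕ+ → ℝ) (n : ℕ+) : weight θ n = θ n := dif_pos n.pos

theorem weight_zero (θ : ℕ+ → ℝ) : weight θ 0 = 1 := dif_neg (lt_irrefl 0)

variable {θ : ℕ+ → ℝ}

theorem weight_pos (hθ : ∀ k, θ k ∈ Set.Ioo (0 : ℝ) 1) (n : ℕ) : 0 < weight θ n := by
  unfold weight
  split_ifs with h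
  · exact (hθ _).1
  · exact one_pos

theorem weight_le_one (hθ : ∀ k, θ k ∈ Set.Ioo (0 : ℝ) 1) (n : ℕ) : weight θ n ≤ 1 := by
  unfold weight
  split_ifs with h
  · exact (hθ _).2.le
  · exact le_rfl

theorem weight_antitone (hθ : IsRegularSeq θ) : Antitone (weight θ) := by
  intro m n hmn
  unfold weight
  split_ifs with h h' h'
  · exact hθ.antitone (PNat.coe_le_coe _ _ |>.1 hmn)
  · exact (hθ.mem_Ioo _).2.le
  · omega
  · exact le_rfl

theorem weight_mul_le (hθ : IsRegularSeq θ) (m n : ℕ) :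
    weight θ m * weight θ n ≤ weight θ (m + n) := by
  rcases Nat.eq_zero_or_pos m with rfl | hm
  · rw [weight_zero, one_mul, zero_add]
  rcases Nat.eq_zero_or_pos n with rfl | hn
  · rw [weight_zero, mul_one, add_zero]
  have := hθ.mul_le ⟨m, hm⟩ ⟨n, hn⟩
  rw [← weight_coe θ ⟨m, hm⟩, ← weight_coe θ ⟨n, hn⟩, ← weight_coe θ (⟨m, hm⟩ + ⟨n, hn⟩)] at this
  exact this

theorem tendsto_weight (hθ : IsRegularSeq θ) : Tendsto (weight θ) atTop (𝓝 0) := by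
  refine (tendsto_add_atTop_iff_nat 1).1 ?_
  have : (fun n => weight θ (n + 1)) = θ ∘ Nat.succPNat := by
    funext n
    exact dif_pos n.succ_pos
  rw [this]
  refine hθ.tendsto_zero.comp (tendsto_atTop_mono (f := Nat.succPNat) (g := Nat.succPNat)
    (fun _ => le_rfl) ?_)
  refine tendsto_atTop_atTop.2 fun b => ⟨b, fun a ha => ?_⟩
  exact PNat.coe_le_coe _ _ |>.1 (ha.trans (Nat.le_succ a))

theorem nrm_nonneg (hθ : ∀ k, θ k ∈ Set.Ioo (0 : ℝ) 1) (x : ℕ+ →₀ ℝ) : 0 ≤ nrm θ x :=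
  (tsirelsonNorm_bounds hθ x).1

theorem nrm_zero (θ : ℕ+ → ℝ) : nrm θ 0 = 0 := by
  have := tsirelsonNorm_smul (M := fun n : ℕ+ => schreier n) (θ := θ) 0 0
  rwa [zero_smul, abs_zero, zero_mul] at this

/-- Restrictions preserve coordinatewise domination, so the property passes through each iterate. It
is the source of unconditionality. -/
theorem normIter_lattice (hθ : ∀ k, θ k ∈ Set.Ioo (0 : ℝ) 1) {M : ℕ+ → Set (Finset ℕ+)} (m : ℕ) :
    ∀ x y : ℕ+ →₀ ℝ, (∀ i, |x i| ≤ |y i|) → normIter M θ m x ≤ normIter M θ m y := by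
  have hsup : ∀ x y : ℕ+ →₀ ℝ, (∀ i, |x i| ≤ |y i|) → supNorm x ≤ supNorm y := fun x y h =>
    ciSup_le fun i => (h i).trans (abs_le_supNorm y i)
  induction m with
  | zero => exact hsup
  | succ m ih =>
    intro x y h
    refine step_le ((hsup x y h).trans (le_max_left _ _)) fun k d E hE => ?_
    refine le_trans ?_ (le_step hθ (normIter_bounds hθ m) y hE)
    refine mul_le_mul_of_nonneg_left (Finset.sum_le_sum fun i _ => ih _ _ fun j => ?_) (hθ k).1.le
    simp only [restrict_apply]
    split_ifs
    · exact h j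
    · exact le_rfl

theorem nrm_lattice (hθ : ∀ k, θ k ∈ Set.Ioo (0 : ℝ) 1) {x y : ℕ+ →₀ ℝ}
    (h : ∀ i, |x i| ≤ |y i|) : nrm θ x ≤ nrm θ y :=
  ciSup_le fun m => (normIter_lattice hθ m x y h).trans (normIter_le hθ m y)

theorem nrm_restrict_le (hθ : ∀ k, θ k ∈ Set.Ioo (0 : ℝ) 1) (E : Finset ℕ+) (x : ℕ+ →₀ ℝ) :
    nrm θ (restrict E x) ≤ nrm θ x := nrm_lattice hθ fun i => by
  rw [restrict_apply]
  split_ifs <;> simp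

theorem nrm_smul (c : ℝ) (x : ℕ+ →₀ ℝ) : nrm θ (c • x) = |c| * nrm θ x := tsirelsonNorm_smul c x

theorem nrm_add_le (hθ : ∀ k, θ k ∈ Set.Ioo (0 : ℝ) 1) (x y : ℕ+ →₀ ℝ) :
    nrm θ (x + y) ≤ nrm θ x + nrm θ y := tsirelsonNorm_add_le hθ x y

theorem nrm_sum_le (hθ : ∀ k, θ k ∈ Set.Ioo (0 : ℝ) 1) {ι : Type*} (s : Finset ι)
    (x : ι → ℕ+ →₀ ℝ) : nrm θ (∑ i ∈ s, x i) ≤ ∑ i ∈ s, nrm θ (x i) :=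
  Finset.le_sum_of_subadditive (nrm θ) (nrm_zero θ).le (nrm_add_le hθ) s x

theorem nrm_pos (hθ : ∀ k, θ k ∈ Set.Ioo (0 : ℝ) 1) {x : ℕ+ →₀ ℝ} (hx : x ≠ 0) : 0 < nrm θ x := by
  obtain ⟨i, hi⟩ := Finsupp.support_nonempty_iff.2 hx
  exact (abs_pos.2 (Finsupp.mem_support_iff.1 hi)).trans_le (abs_le_tsirelsonNorm hθ x i)

theorem weight_mul_sum_le (hθ : ∀ k, θ k ∈ Set.Ioo (0 : ℝ) 1) {n : ℕ} (hn : 0 < n) {ι : Type}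
    [Fintype ι] {F : ι → Finset ℕ+} (hF : AdmFam n F) (x : ℕ+ →₀ ℝ) :
    weight θ n * ∑ i, nrm θ (restrict (F i) x) ≤ nrm θ x := by
  obtain ⟨d, e, he⟩ := hF.exists_equiv
  have h := le_step (M := fun n : ℕ+ => schreier n) (N := nrm θ) hθ
    (tsirelsonNorm_bounds hθ) x (k := ⟨n, hn⟩) he
  rw [e.sum_comp fun i => nrm θ (restrict (F i) x)] at h
  rw [show weight θ n = θ ⟨n, hn⟩ from dif_pos hn]
  exact h.trans_eq (tsirelsonNorm_eq hθ x).symm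

/-- `z` is flat of order `J` if the sum of the norms of its restrictions to the members of an
`𝓕_J`-admissible family is at most `C`. -/
def Flat (θ : ℕ+ → ℝ) (J : ℕ) (C : ℝ) (z : ℕ+ →₀ ℝ) : Prop :=
  ∀ (ι : Type) [Fintype ι] (F : ι → Finset ℕ+), AdmFam J F → ∑ i, nrm θ (restrict (F i) z) ≤ C

theorem Flat.mono {J J' : ℕ} {C C' : ℝ} {z : ℕ+ →₀ ℝ} (h : Flat θ J C z) (hJ : J' ≤ J)
    (hC : C ≤ C') : Flat θ J' C' z := fun ι _ F hF => (h ι F (hF.mono hJ)).trans hC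

theorem Flat.smul {J : ℕ} {C : ℝ} {z : ℕ+ →₀ ℝ} (h : Flat θ J C z) (c : ℝ) :
    Flat θ J (|c| * C) (c • z) := fun ι _ F hF => by
  simp only [restrict_smul, nrm_smul, ← Finset.mul_sum]
  exact mul_le_mul_of_nonneg_left (h ι F hF) (abs_nonneg c)

theorem Flat.nonneg {J : ℕ} {C : ℝ} {z : ℕ+ →₀ ℝ} (h : Flat θ J C z) : 0 ≤ C := by
  simpa using h Empty (fun i => i.elim) (AdmFam.of_subsingleton fun i => i.elim)

theorem Flat.nrm_le {J : ℕ} {C : ℝ} {z : ℕ+ →₀ ℝ} (h : Flat θ J C z) : nrm θ z ≤ C := by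
  rcases eq_or_ne z 0 with rfl | hz
  · rw [nrm_zero]
    exact h.nonneg
  · have := h Unit (fun _ => z.support)
      (AdmFam.of_subsingleton fun _ => Finsupp.support_nonempty_iff.2 hz)
    simpa [restrict_eq_self] using this

/-- A bound independent of the order: a fixed vector becomes negligible for functionals of
sufficiently large weight order. -/
theorem flat_l1 (hθ : ∀ k, θ k ∈ Set.Ioo (0 : ℝ) 1) (J : ℕ) (z : ℕ+ →₀ ℝ) :
    Flat θ J (l1 z) z := by
  intro ι _ F hF
  obtain ⟨d, e, he⟩ := hF.exists_equiv
  rw [← e.sum_comp fun i => nrm θ (restrict (F i) z)]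
  exact (Finset.sum_le_sum fun i _ => (tsirelsonNorm_bounds hθ _).2).trans
    (sum_l1_restrict_le _ he.1 z)

theorem flat_of_nrm_le (hθ : ∀ k, θ k ∈ Set.Ioo (0 : ℝ) 1) {J : ℕ} (hJ : 0 < J) {C : ℝ}
    {z : ℕ+ →₀ ℝ} (h : nrm θ z ≤ C) : Flat θ J (C / weight θ J) z := fun ι _ F hF => by
  rw [le_div_iff₀ (weight_pos hθ J), mul_comm]
  exact (weight_mul_sum_le hθ hJ hF z).trans h

/-! ### Norming functionals -/

/-- The functionals given by the trees that define the norm, together with a set that carries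
them. -/
inductive Norming (θ : ℕ+ → ℝ) : Finset ℕ+ → ((ℕ+ →₀ ℝ) →ₗ[ℝ] ℝ) → Prop
  | coord (i : ℕ+) (c : ℝ) (hc : |c| ≤ 1) : Norming θ {i} (c • Finsupp.lapply i)
  | node {ι : Type} [Fintype ι] (k : ℕ+) (E : ι → Finset ℕ+) (h : ι → (ℕ+ →₀ ℝ) →ₗ[ℝ] ℝ)
      (hE : AdmFam k E) (hh : ∀ i, Norming θ (E i) (h i)) :
      Norming θ (Finset.univ.biUnion E) (θ k • ∑ i, h i)

/-- The functional `g` takes values at most `θ_r C` on vectors that are flat of order `r` with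
constant `C`. -/
def HasWeight (θ : ℕ+ → ℝ) (r : ℕ) (g : (ℕ+ →₀ ℝ) →ₗ[ℝ] ℝ) : Prop :=
  ∀ (C : ℝ) (z : ℕ+ →₀ ℝ), Flat θ r C z → g z ≤ weight θ r * C

namespace Norming

variable {E : Finset ℕ+} {f : (ℕ+ →₀ ℝ) →ₗ[ℝ] ℝ}

theorem zero (θ : ℕ+ → ℝ) : Norming θ ∅ 0 := by
  have := node (θ := θ) (ι := Empty) 1 (fun i => i.elim) (fun i => i.elim)
    (AdmFam.of_subsingleton fun i => i.elim) (fun i => i.elim)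
  simpa using this

theorem apply_restrict (hf : Norming θ E f) {F : Finset ℕ+} (hF : E ⊆ F) (x : ℕ+ →₀ ℝ) :
    f (restrict F x) = f x := by
  induction hf with
  | coord i c hc => simp [restrict_apply, hF (Finset.mem_singleton_self i)]
  | node k E h hE hh ih =>
    simp only [LinearMap.smul_apply, LinearMap.sum_apply]
    congr 1
    exact Finset.sum_congr rfl fun i _ =>
      ih i ((Finset.subset_biUnion_of_mem E (Finset.mem_univ i)).trans hF)

theorem apply_le (hθ : ∀ k, θ k ∈ Set.Ioo (0 : ℝ) 1) (hf : Norming θ E f) (x : ℕ+ →₀ ℝ) :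
    f x ≤ nrm θ x := by
  induction hf generalizing x with
  | coord i c hc =>
    calc c * x i ≤ |c * x i| := le_abs_self _
      _ = |c| * |x i| := abs_mul _ _
      _ ≤ 1 * |x i| := by gcongr
      _ ≤ nrm θ x := by
        rw [one_mul]
        exact abs_le_tsirelsonNorm hθ x i
  | node k E h hE hh ih =>
    simp only [LinearMap.smul_apply, LinearMap.sum_apply, smul_eq_mul]
    refine le_trans ?_ (weight_mul_sum_le hθ k.pos hE x)
    rw [weight_coe]
    refine mul_le_mul_of_nonneg_left (Finset.sum_le_sum fun i _ => ?_) (hθ k).1.le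
    rw [← (hh i).apply_restrict subset_rfl]
    exact ih i _

theorem apply_le_restrict (hθ : ∀ k, θ k ∈ Set.Ioo (0 : ℝ) 1) (hf : Norming θ E f)
    (x : ℕ+ →₀ ℝ) : f x ≤ nrm θ (restrict E x) := by
  rw [← hf.apply_restrict subset_rfl]
  exact hf.apply_le hθ _

theorem hasWeight_node (hθ : ∀ k, θ k ∈ Set.Ioo (0 : ℝ) 1) {ι : Type} [Fintype ι] {k : ℕ+}
    {E : ι → Finset ℕ+} {h : ι → (ℕ+ →₀ ℝ) →ₗ[ℝ] ℝ} (hE : AdmFam k E)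
    (hh : ∀ i, Norming θ (E i) (h i)) : HasWeight θ k (θ k • ∑ i, h i) := by
  intro C z hz
  simp only [LinearMap.smul_apply, LinearMap.sum_apply, smul_eq_mul]
  rw [weight_coe]
  exact mul_le_mul_of_nonneg_left ((Finset.sum_le_sum fun i _ =>
    (hh i).apply_le_restrict hθ z).trans (hz _ E hE)) (hθ k).1.le

theorem eq_zero (hf : Norming θ E f) (hE : ¬ E.Nonempty) : f = 0 := by
  ext x
  rw [Finset.not_nonempty_iff_eq_empty] at hE
  subst hE
  have h : restrict ∅ (Finsupp.single x (1 : ℝ)) = 0 := restrict_eq_zero fun _ _ => by simp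
  have := hf.apply_restrict subset_rfl (Finsupp.single x (1 : ℝ))
  rw [h, map_zero] at this
  simpa using this.symm

/-- Approximation up to `η` avoids the question of attainment. The set `W` confines the carrier, so
that functionals chosen for separated sets stay separated. -/
theorem exists_normIter_le (hθ : ∀ k, θ k ∈ Set.Ioo (0 : ℝ) 1) (m : ℕ) :
    ∀ (x : ℕ+ →₀ ℝ) (W : Finset ℕ+), x.support ⊆ W → ∀ η > (0 : ℝ), ∃ E f, Norming θ E f ∧ E ⊆ W ∧
      normIter (fun n : ℕ+ => schreier n) θ m x - η ≤ f x := by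
  have hsup : ∀ (x : ℕ+ →₀ ℝ) (W : Finset ℕ+), x.support ⊆ W → ∀ η > (0 : ℝ), ∃ E f,
      Norming θ E f ∧ E ⊆ W ∧ supNorm x - η ≤ f x := by
    intro x W hW η hη
    obtain ⟨i, hi⟩ := exists_lt_of_lt_ciSup (sub_lt_self (supNorm x) hη)
    by_cases h : i ∈ x.support
    · refine ⟨{i}, _, coord i (SignType.sign (x i) : ℝ) ?_,
        Finset.singleton_subset_iff.2 (hW h), ?_⟩
      · rcases SignType.sign (x i) with _ | _ | _ <;> simp
      · simpa using hi.le
    · refine ⟨∅, 0, zero θ, Finset.empty_subset _, ?_⟩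
      rw [Finsupp.notMem_support_iff.1 h, abs_zero] at hi
      simpa using hi.le
  induction m with
  | zero => exact hsup
  | succ m ih =>
    intro x W hW η hη
    change ∃ E f, Norming θ E f ∧ E ⊆ W ∧ step _ θ _ x - η ≤ f x
    by_contra! hcon
    -- If no functional comes within `η`, every competitor in the defining supremum misses it by `η
    -- / 2`, which is absurd.
    have hstep : step (fun n : ℕ+ => schreier n) θ (normIter (fun n : ℕ+ => schreier n) θ m) x ≤
        step (fun n : ℕ+ => schreier n) θ (normIter (fun n : ℕ+ => schreier n) θ m) x - η / 2 := by
      refine step_le ?_ fun k d E hE => ?_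
      · obtain ⟨E, f, hf, hE, h⟩ := hsup x W hW (η / 2) (half_pos hη)
        have := hcon E f hf hE
        linarith
      · have hη' : 0 < η / 2 / (d + 1) := by positivity
        choose F f hf hF hle using fun i => ih (restrict (E i) x) (E i ∩ W) (by
          rw [support_restrict, Finset.inter_comm]
          exact Finset.inter_subset_inter_left hW) _ hη'
        -- Admissible families have nonempty members; functionals with empty carrier vanish and can
        -- be dropped.
        let κ := {i : Fin d // (F i).Nonempty}
        have hE' : AdmFam k fun i : κ => F i.1 :=
          (AdmFam.of_admissible hE).comp_subset Subtype.val_injective (fun i => i.2)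
            fun i => (hF i).trans Finset.inter_subset_left
        have hnode := node k _ _ hE' fun i : κ => hf i.1
        have hlt := hcon _ _ hnode (Finset.biUnion_subset.2 fun i _ =>
          (hF i.1).trans Finset.inter_subset_right)
        have hsum : ∑ i : κ, f i.1 x = ∑ i, f i x := by
          rw [← Finset.sum_subtype (Finset.univ.filter fun i => (F i).Nonempty) (by simp)
            fun i => f i x]
          refine Finset.sum_filter_of_ne fun i _ hne => ?_
          by_contra h
          exact hne (by rw [(hf i).eq_zero h, LinearMap.zero_apply])
        simp only [LinearMap.smul_apply, LinearMap.sum_apply, smul_eq_mul, hsum] at hlt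
        have hfx : ∀ i, f i (restrict (E i) x) = f i x := fun i =>
          (hf i).apply_restrict ((hF i).trans Finset.inter_subset_left) x
        have hS : ∑ i, normIter (fun n : ℕ+ => schreier n) θ m (restrict (E i) x) ≤
            ∑ i, f i x + η / 2 := by
          calc ∑ i, normIter (fun n : ℕ+ => schreier n) θ m (restrict (E i) x)
              ≤ ∑ i, (f i x + η / 2 / (d + 1)) := Finset.sum_le_sum fun i _ => by
                have := hle i
                rw [hfx] at this
                linarith
            _ = ∑ i, f i x + d * (η / 2 / (d + 1)) := by simp [Finset.sum_add_distrib]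
            _ ≤ ∑ i, f i x + (d + 1) * (η / 2 / (d + 1)) := by gcongr; linarith
            _ = _ := by field_simp
        have h1 := mul_le_mul_of_nonneg_left hS (hθ k).1.le
        have h2 : θ k * (η / 2) ≤ η / 2 := mul_le_of_le_one_left (half_pos hη).le (hθ k).2.le
        rw [mul_add] at h1
        linarith
    linarith

theorem exists_nrm_le (hθ : ∀ k, θ k ∈ Set.Ioo (0 : ℝ) 1) {x : ℕ+ →₀ ℝ} {W : Finset ℕ+}
    (hW : x.support ⊆ W) {η : ℝ} (hη : 0 < η) :
    ∃ E f, Norming θ E f ∧ E ⊆ W ∧ nrm θ x - η ≤ f x := by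
  obtain ⟨m, hm⟩ := exists_lt_of_lt_ciSup (sub_lt_self (nrm θ x) (half_pos hη))
  obtain ⟨E, f, hf, hE, h⟩ := exists_normIter_le hθ m x W hW _ (half_pos hη)
  exact ⟨E, f, hf, hE, by linarith⟩

end Norming

/-! ### Cutting a norming functional at a given order -/

/-- A norming functional can be cut at order `p + 1`: it is a combination of norming functionals
`g b`, carried by an `𝓕_p`-admissible family, each of which is a multiple of a coordinate
functional or has a weight that brings the accumulated order to at least `p + 1`. -/
theorem Norming.frontier (hθ : IsRegularSeq θ) {E : Finset ℕ+} {f : (ℕ+ →₀ ℝ) →ₗ[ℝ] ℝ}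
    (hf : Norming θ E f) (p : ℕ) :
    ∃ (κ : Type) (_ : Fintype κ) (F : κ → Finset ℕ+) (g : κ → (ℕ+ →₀ ℝ) →ₗ[ℝ] ℝ) (c : κ → ℝ)
      (m : κ → ℕ), AdmFam p F ∧ (∀ b, F b ⊆ E) ∧ f = ∑ b, c b • g b ∧
      ∀ b, Norming θ (F b) (g b) ∧ 0 ≤ c b ∧ c b ≤ weight θ (m b) ∧
        ((∃ i, F b = {i}) ∨ ∃ r, p + 1 ≤ m b + r ∧ HasWeight θ r (g b)) := by
  induction hf generalizing p with
  | coord i c hc =>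
    exact ⟨Unit, inferInstance, fun _ => {i}, fun _ => c • Finsupp.lapply i, fun _ => 1, fun _ => 0,
      AdmFam.of_subsingleton fun _ => Finset.singleton_nonempty i, fun _ => subset_rfl, by simp,
      fun _ => ⟨coord i c hc, zero_le_one, (weight_zero θ).ge, Or.inl ⟨i, rfl⟩⟩⟩
  | @node ι _ k E h hE hh ih =>
    rcases isEmpty_or_nonempty ι with hι | ⟨⟨i₀⟩⟩
    · exact ⟨Empty, inferInstance, fun _ => ∅, fun _ => 0, fun _ => 0, fun _ => 0,
        AdmFam.of_subsingleton fun i => i.elim, fun i => i.elim, by simp, fun i => i.elim⟩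
    -- A node of order `k > p` is kept whole, its own weight supplying the missing order. Otherwise
    -- `k` is deducted from the budget, the children are cut at `p - k`, and the factor `θ k` goes
    -- into the coefficient.
    rcases lt_or_ge p k with hpk | hkp
    · refine ⟨Unit, inferInstance, fun _ => Finset.univ.biUnion E, fun _ => θ k • ∑ i, h i,
        fun _ => 1, fun _ => 0, AdmFam.of_subsingleton fun _ => ?_, fun _ => subset_rfl, by simp,
        fun _ => ⟨node k E h hE hh, zero_le_one, (weight_zero θ).ge,
          Or.inr ⟨k, by omega, hasWeight_node hθ.mem_Ioo hE hh⟩⟩⟩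
      obtain ⟨x, hx⟩ := hE.nonempty i₀
      exact ⟨x, Finset.mem_biUnion.2 ⟨i₀, Finset.mem_univ _, hx⟩⟩
    · choose κ inst F g c m hF hFE hfg hb using fun i => ih i (p - k)
      refine ⟨Σ i, κ i, inferInstance, fun b => F b.1 b.2, fun b => g b.1 b.2,
        fun b => θ k * c b.1 b.2, fun b => k + m b.1 b.2, ?_, ?_, ?_, ?_⟩
      · have := hE.sigma hF hFE
        rwa [Nat.sub_add_cancel hkp] at this
      · exact fun b => (hFE b.1 b.2).trans (Finset.subset_biUnion_of_mem E (Finset.mem_univ b.1))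
      · rw [Fintype.sum_sigma, Finset.smul_sum]
        refine Finset.sum_congr rfl fun i _ => ?_
        rw [hfg i, Finset.smul_sum]
        exact Finset.sum_congr rfl fun b _ => smul_smul _ _ _
      · rintro ⟨i, b⟩
        obtain ⟨h₁, h₂, h₃, h₄⟩ := hb i b
        refine ⟨h₁, mul_nonneg (hθ.mem_Ioo k).1.le h₂, ?_, h₄.imp id ?_⟩
        · refine le_trans ?_ (weight_mul_le hθ _ _)
          rw [weight_coe]
          exact mul_le_mul_of_nonneg_left h₃ (hθ.mem_Ioo k).1.le
        · rintro ⟨r, hr, hw⟩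
          exact ⟨r, by simp only; omega, hw⟩

/-- Each restricted norm is replaced by an almost norming functional carried by its set, and all of
these are cut at once. The order of the family and that of the cut add up. -/
theorem AdmFam.frontier (hθ : IsRegularSeq θ) {J : ℕ} {ι : Type} [Fintype ι] {F : ι → Finset ℕ+}
    (hF : AdmFam J F) (p : ℕ) (x : ℕ+ →₀ ℝ) {η : ℝ} (hη : 0 < η) :
    ∃ (κ : Type) (_ : Fintype κ) (H : κ → Finset ℕ+) (g : κ → (ℕ+ →₀ ℝ) →ₗ[ℝ] ℝ) (c : κ → ℝ)
      (m : κ → ℕ), AdmFam (p + J) H ∧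
      ∑ i, nrm θ (restrict (F i) x) ≤ ∑ b, c b * g b x + η ∧
      ∀ b, Norming θ (H b) (g b) ∧ 0 ≤ c b ∧ c b ≤ weight θ (m b) ∧
        ((∃ i, H b = {i}) ∨ ∃ r, p + 1 ≤ m b + r ∧ HasWeight θ r (g b)) := by
  have hη' : 0 < η / (Fintype.card ι + 1) := by positivity
  choose E f hf hEF hle using fun i => Norming.exists_nrm_le hθ.mem_Ioo
    (x := restrict (F i) x) (W := F i)
    (by rw [support_restrict]; exact Finset.inter_subset_right) hη'
  choose κ inst H g c m hH hHE hfg hb using fun i => (hf i).frontier hθ p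
  refine ⟨Σ i, κ i, inferInstance, fun b => H b.1 b.2, fun b => g b.1 b.2, fun b => c b.1 b.2,
    fun b => m b.1 b.2, hF.sigma hH fun i b => (hHE i b).trans (hEF i), ?_, fun b => hb b.1 b.2⟩
  have h1 : ∀ i, ∑ b, c i b * g i b x = f i x := fun i => by
    rw [hfg i]
    simp
  rw [Fintype.sum_sigma]
  simp only [h1]
  calc ∑ i, nrm θ (restrict (F i) x) ≤ ∑ i, (f i x + η / (Fintype.card ι + 1)) :=
        Finset.sum_le_sum fun i _ => by
          have := hle i
          rw [(hf i).apply_restrict (hEF i)] at this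
          linarith
    _ = ∑ i, f i x + Fintype.card ι * (η / (Fintype.card ι + 1)) := by
        simp [Finset.sum_add_distrib]
    _ ≤ ∑ i, f i x + (Fintype.card ι + 1) * (η / (Fintype.card ι + 1)) := by
        gcongr
        linarith
    _ = _ := by field_simp

/-! ### Averages of blocks -/

theorem schreier_image_spread {p : ℕ} {A : Finset ℕ} {t u : ℕ → ℕ+} {S : Finset ℕ+}
    (hS : S ∈ schreier p) (ht : ∀ k ∈ A, t k ∈ S) (htm : StrictMonoOn t A) (hu : StrictMono u)
    (htu : ∀ k ∈ A, t k ≤ u k) : A.image u ∈ schreier p := by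
  let inv := Function.invFun u
  have hinv : ∀ k, inv (u k) = k := Function.leftInverse_invFun hu.injective
  refine schreier_spread (φ := fun x => t (inv x)) hS ?_ ?_ ?_
  · intro b hb
    obtain ⟨k, hk, rfl⟩ := Finset.mem_image.1 hb
    simpa only [hinv] using ht k hk
  · intro b hb c hc hbc
    obtain ⟨k, hk, rfl⟩ := Finset.mem_image.1 hb
    obtain ⟨l, hl, rfl⟩ := Finset.mem_image.1 hc
    simpa only [hinv] using htm hk hl (hu.lt_iff_lt.1 hbc)
  · intro b hb
    obtain ⟨k, hk, rfl⟩ := Finset.mem_image.1 hb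
    simpa only [hinv] using htu k hk

/-- The contribution of an `𝓕_p`-admissible family to an average of blocks which is small on
`𝓕_p`-sets: up to a small error, a block is met by only one member of the family, which starts
before the block. One exceptional block is allowed for each member of the family. -/
theorem sum_average_le {lo hi : ℕ → ℕ+} (h₁ : ∀ k, lo k ≤ hi k) (h₂ : ∀ k, hi k < lo (k + 1))
    {G : Finset ℕ} {a : ℕ → ℝ} (ha : ∀ k ∈ G, 0 ≤ a k) (hsum : ∑ k ∈ G, a k = 1) {p : ℕ} {δ : ℝ}
    (hsmall : ∀ A ⊆ G, A.image hi ∈ schreier p → ∑ k ∈ A, a k ≤ δ) {κ : Type} [Fintype κ]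
    {H : κ → Finset ℕ+} (hH : AdmFam p H) {Exc : κ → ℕ → Prop}
    (hExc : ∀ b k l, Exc b k → Exc b l → k = l) {τ : κ → ℕ → ℝ} {B D : ℝ} (hB : 0 ≤ B) (hD : 0 ≤ D)
    (hτ₀ : ∀ b, ∀ k ∈ G, (∀ x ∈ H b, lo k ≤ x → hi k < x) → τ b k ≤ 0)
    (hτB : ∀ k ∈ G, ∑ b, τ b k ≤ B)
    (hτD : ∀ b, ∀ k ∈ G, minElt (H b) < lo k → (∃ x ∈ H b, lo k ≤ x) → ¬ Exc b k → τ b k ≤ D) :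
    ∑ k ∈ G, a k * ∑ b, τ b k ≤ D + 2 * δ * B := by
  classical
  have hhi : StrictMono hi := strictMono_nat_of_lt_succ fun k => (h₂ k).trans_le (h₁ _)
  have hlo : StrictMono lo := strictMono_nat_of_lt_succ fun k => (h₁ k).trans_lt (h₂ _)
  have hlt : ∀ {k l}, k < l → hi k < lo l := fun {k l} h =>
    (h₂ k).trans_le (hlo.monotone (Nat.succ_le_of_lt h))
  -- Blocks in which some member starts, and other blocks met by a member for which they are
  -- exceptional. In both cases the right endpoints form a spread of a set of minima of the family,
  -- so the total weight is at most `δ`.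
  let Bad : ℕ → Prop := fun k => ∃ b, lo k ≤ minElt (H b) ∧ minElt (H b) ≤ hi k
  let Ex : ℕ → Prop := fun k => ¬ Bad k ∧ ∃ b, Exc b k ∧ ∃ x ∈ H b, lo k ≤ x ∧ x ≤ hi k
  have hbad : ∑ k ∈ G.filter Bad, a k ≤ δ := by
    refine hsmall _ (Finset.filter_subset _ _) ?_
    have : ∀ k, ∃ t, Bad k → (∃ b, t = minElt (H b)) ∧ lo k ≤ t ∧ t ≤ hi k := fun k => by
      by_cases h : Bad k
      · obtain ⟨b, hb⟩ := h
        exact ⟨_, fun _ => ⟨⟨b, rfl⟩, hb⟩⟩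
      · exact ⟨1, fun h' => absurd h' h⟩
    choose t ht using this
    have ht' : ∀ k ∈ G.filter Bad, (∃ b, t k = minElt (H b)) ∧ lo k ≤ t k ∧ t k ≤ hi k :=
      fun k hk => ht k (Finset.mem_filter.1 hk).2
    refine schreier_image_spread (t := t) hH.mem (fun k hk => ?_) (fun k hk l hl hkl => ?_) hhi
      fun k hk => (ht' k hk).2.2
    · obtain ⟨b, hb⟩ := (ht' k hk).1
      exact hb ▸ Finset.mem_image_of_mem _ (Finset.mem_univ b)
    · exact ((ht' k hk).2.2.trans_lt (hlt hkl)).trans_le (ht' l hl).2.1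
  have hex : ∑ k ∈ G.filter Ex, a k ≤ δ := by
    refine hsmall _ (Finset.filter_subset _ _) ?_
    rcases isEmpty_or_nonempty κ with hκ | ⟨⟨b₀⟩⟩
    · rw [Finset.filter_false_of_mem]
      · simpa using empty_mem_schreier p
      · rintro k - ⟨-, b, -⟩
        exact isEmptyElim b
    have : ∀ k, ∃ b, Ex k → Exc b k ∧ ∃ x ∈ H b, lo k ≤ x ∧ x ≤ hi k := fun k => by
      by_cases h : Ex k
      · obtain ⟨-, b, hb⟩ := h
        exact ⟨b, fun _ => hb⟩
      · exact ⟨b₀, fun h' => absurd h' h⟩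
    choose t ht using this
    have ht' : ∀ k ∈ G.filter Ex, Exc (t k) k ∧ ∃ x ∈ H (t k), lo k ≤ x ∧ x ≤ hi k :=
      fun k hk => ht k (Finset.mem_filter.1 hk).2
    refine schreier_image_spread (t := fun k => minElt (H (t k))) hH.mem
      (fun k _ => Finset.mem_image_of_mem _ (Finset.mem_univ (t k))) (fun k hk l hl hkl => ?_) hhi
      fun k hk => ?_
    · obtain ⟨hk, x, hx, -, hxk⟩ := ht' k hk
      obtain ⟨hl, y, hy, hyl, -⟩ := ht' l hl
      -- One exceptional block per member makes the chosen members distinct; being separated, they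
      -- are ordered as the blocks they meet.
      have hne : t k ≠ t l := fun h => hkl.ne (hExc _ _ _ hk (h ▸ hl))
      rcases hH.sep _ _ hne with h | h
      · exact h _ (minElt_mem (hH.nonempty _)) _ (minElt_mem (hH.nonempty _))
      · exact absurd (h y hy x hx) ((hxk.trans_lt (hlt hkl)).trans_le hyl).not_gt
    · obtain ⟨-, x, hx, -, hxk⟩ := ht' k hk
      exact (minElt_le hx).trans hxk
  have key : ∀ k ∈ G, ∑ b, τ b k ≤ D + ((if Bad k then B else 0) + if Ex k then B else 0) := by
    intro k hk
    by_cases hb : Bad k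
    · have := hτB k hk
      rw [if_pos hb]
      split_ifs <;> linarith
    by_cases he : Ex k
    · have := hτB k hk
      rw [if_neg hb, if_pos he]
      linarith
    rw [if_neg hb, if_neg he, add_zero, add_zero]
    -- Members meeting this block all start before it, and two of them would interleave; hence at
    -- most one meets it.
    by_cases hm : ∃ b, ∃ x ∈ H b, lo k ≤ x ∧ x ≤ hi k
    · obtain ⟨b, x, hx, hx₁, hx₂⟩ := hm
      have hmin : ∀ b, ∀ x ∈ H b, lo k ≤ x → x ≤ hi k → minElt (H b) < lo k :=
        fun b x hx _ hx₂ => not_le.1 fun h => hb ⟨b, h, (minElt_le hx).trans hx₂⟩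
      have huniq : ∀ b' ≠ b, τ b' k ≤ 0 := by
        intro b' hne
        refine hτ₀ b' k hk fun y hy hy₁ => not_le.1 fun hy₂ => ?_
        rcases hH.sep _ _ hne with h | h
        · exact absurd (h y hy _ (minElt_mem (hH.nonempty b)))
            ((hmin b x hx hx₁ hx₂).trans_le hy₁).not_gt
        · exact absurd (h x hx _ (minElt_mem (hH.nonempty b')))
            ((hmin b' y hy hy₁ hy₂).trans_le hx₁).not_gt
      rw [← Finset.add_sum_erase _ _ (Finset.mem_univ b)]
      have h1 := hτD b k hk (hmin b x hx hx₁ hx₂) ⟨x, hx, hx₁⟩ fun h =>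
        he ⟨hb, b, h, x, hx, hx₁, hx₂⟩
      have h2 : ∑ b' ∈ Finset.univ.erase b, τ b' k ≤ 0 :=
        Finset.sum_nonpos fun b' hb' => huniq b' (Finset.ne_of_mem_erase hb')
      linarith
    · push Not at hm
      exact (Finset.sum_nonpos fun b _ => hτ₀ b k hk (hm b)).trans hD
  calc ∑ k ∈ G, a k * ∑ b, τ b k
      ≤ ∑ k ∈ G, a k * (D + ((if Bad k then B else 0) + if Ex k then B else 0)) :=
        Finset.sum_le_sum fun k hk => mul_le_mul_of_nonneg_left (key k hk) (ha k hk)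
    _ = (∑ k ∈ G, a k) * D + ((∑ k ∈ G.filter Bad, a k) * B + (∑ k ∈ G.filter Ex, a k) * B) := by
        simp only [mul_add, Finset.sum_add_distrib, mul_ite, mul_zero, Finset.sum_filter,
          Finset.sum_mul, ite_mul, zero_mul]
    _ ≤ 1 * D + (δ * B + δ * B) := by
        rw [hsum]
        gcongr
    _ = D + 2 * δ * B := by ring

/-- `y` has a lower estimate of order `s` with constant `c`. -/
def LowerEst (θ : ℕ+ → ℝ) (s : ℕ) (c : ℝ) (y : ℕ+ →₀ ℝ) : Prop :=
  ∃ (ι : Type) (_ : Fintype ι) (F : ι → Finset ℕ+), AdmFam s F ∧ (∀ i, F i ⊆ y.support) ∧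
    c ≤ ∑ i, nrm θ (restrict (F i) y)

theorem LowerEst.le_nrm (hθ : ∀ k, θ k ∈ Set.Ioo (0 : ℝ) 1) {s : ℕ} (hs : 0 < s) {c : ℝ}
    {y : ℕ+ →₀ ℝ} (h : LowerEst θ s c y) : weight θ s * c ≤ nrm θ y := by
  obtain ⟨ι, _, F, hF, -, hc⟩ := h
  exact (mul_le_mul_of_nonneg_left hc (weight_pos hθ s).le).trans (weight_mul_sum_le hθ hs hF y)

theorem lowerEst_nrm {y : ℕ+ →₀ ℝ} (hy : y ≠ 0) (s : ℕ) : LowerEst θ s (nrm θ y) y :=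
  ⟨Unit, inferInstance, fun _ => y.support,
    AdmFam.of_subsingleton fun _ => Finsupp.support_nonempty_iff.2 hy, fun _ => subset_rfl, by
      simp [restrict_eq_self]⟩

theorem lt_of_blocks {lo hi : ℕ → ℕ+} (h₁ : ∀ k, lo k ≤ hi k) (h₂ : ∀ k, hi k < lo (k + 1))
    {k l : ℕ} (h : k < l) : hi k < lo l :=
  (h₂ k).trans_le ((strictMono_nat_of_lt_succ fun k => (h₁ k).trans_lt (h₂ _)).monotone
    (Nat.succ_le_of_lt h))

theorem block_unique {lo hi : ℕ → ℕ+} (h₁ : ∀ k, lo k ≤ hi k) (h₂ : ∀ k, hi k < lo (k + 1))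
    {k l : ℕ} {x : ℕ+} (hk : x ∈ Finset.Icc (lo k) (hi k)) (hl : x ∈ Finset.Icc (lo l) (hi l)) :
    k = l := by
  rw [Finset.mem_Icc] at hk hl
  rcases lt_trichotomy k l with h | h | h
  · exact absurd (lt_of_blocks h₁ h₂ h) (hl.1.trans hk.2).not_gt
  · exact h
  · exact absurd (lt_of_blocks h₁ h₂ h) (hk.1.trans hl.2).not_gt

theorem sum_blocks_apply {lo hi : ℕ → ℕ+} (h₁ : ∀ k, lo k ≤ hi k) (h₂ : ∀ k, hi k < lo (k + 1))
    {y : ℕ → ℕ+ →₀ ℝ} (hy : ∀ k, (y k).support ⊆ Finset.Icc (lo k) (hi k)) {G : Finset ℕ}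
    (a : ℕ → ℝ) {k : ℕ} (hk : k ∈ G) {x : ℕ+} (hx : x ∈ Finset.Icc (lo k) (hi k)) :
    (∑ l ∈ G, a l • y l) x = a k * y k x := by
  rw [Finsupp.finsetSum_apply, Finset.sum_eq_single k]
  · rfl
  · intro l _ hl
    have : x ∉ (y l).support := fun h => hl (block_unique h₁ h₂ (hy l h) hx)
    rw [Finsupp.smul_apply, Finsupp.notMem_support_iff.1 this, smul_zero]
  · exact fun h => absurd hk h

/-- Averages of blocks inherit lower estimates. -/
theorem LowerEst.average {lo hi : ℕ → ℕ+} (h₁ : ∀ k, lo k ≤ hi k) (h₂ : ∀ k, hi k < lo (k + 1))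
    {y : ℕ → ℕ+ →₀ ℝ} (hy : ∀ k, (y k).support ⊆ Finset.Icc (lo k) (hi k)) {s : ℕ} {c : ℝ}
    (hlow : ∀ k, LowerEst θ s c (y k)) {G : Finset ℕ} {a : ℕ → ℝ} (ha : ∀ k ∈ G, 0 < a k)
    (hsum : ∑ k ∈ G, a k = 1) {p : ℕ} (hG : G.image lo ∈ schreier p) :
    LowerEst θ (s + p) c (∑ k ∈ G, a k • y k) := by
  choose ι inst F hF hFy hc using hlow
  have hI : AdmFam p fun k : {k // k ∈ G} => Finset.Icc (lo k) (hi k) := by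
    have hne : ∀ k, (Finset.Icc (lo k) (hi k)).Nonempty := fun k => Finset.nonempty_Icc.2 (h₁ k)
    have hmin : ∀ k, minElt (Finset.Icc (lo k) (hi k)) = lo k := fun k =>
      le_antisymm (minElt_le (Finset.left_mem_Icc.2 (h₁ k)))
        (Finset.mem_Icc.1 (minElt_mem (hne k))).1
    refine ⟨fun k => hne k, fun k l hkl => ?_, ?_⟩
    · have hlt : ∀ {k l : ℕ}, k < l →
          Before (Finset.Icc (lo k) (hi k)) (Finset.Icc (lo l) (hi l)) := fun h x hx y hy =>
        ((Finset.mem_Icc.1 hx).2.trans_lt (lt_of_blocks h₁ h₂ h)).trans_le (Finset.mem_Icc.1 hy).1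
      rcases lt_or_gt_of_ne (Subtype.coe_injective.ne hkl) with h | h
      · exact Or.inl (hlt h)
      · exact Or.inr (hlt h)
    · convert hG using 1
      ext x
      simp [hmin]
  refine ⟨Σ k : {k // k ∈ G}, ι k, inferInstance, fun b => F b.1 b.2,
    hI.sigma (fun k => hF k) fun k i => (hFy k i).trans (hy k), ?_, ?_⟩
  · rintro ⟨⟨k, hk⟩, i⟩ x hx
    have hx' := hFy k i hx
    rw [Finsupp.mem_support_iff, sum_blocks_apply h₁ h₂ hy a hk (hy k hx')]
    exact mul_ne_zero (ha k hk).ne' (Finsupp.mem_support_iff.1 hx')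
  · rw [Fintype.sum_sigma]
    have hr : ∀ (k : {k // k ∈ G}) (i : ι k),
        nrm θ (restrict (F k i) (∑ l ∈ G, a l • y l)) = a k * nrm θ (restrict (F k i) (y k)) := by
      intro k i
      have : restrict (F k i) (∑ l ∈ G, a l • y l) = a k • restrict (F k i) (y k) := by
        ext x
        rw [restrict_apply, Finsupp.smul_apply, restrict_apply]
        split_ifs with h
        · exact sum_blocks_apply h₁ h₂ hy a k.2 (hy k (hFy k i h))
        · simp
      rw [this, nrm_smul, abs_of_pos (ha k k.2)]
    simp only [hr, ← Finset.mul_sum]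
    calc c = ∑ k ∈ G, a k * c := by rw [← Finset.sum_mul, hsum, one_mul]
      _ = ∑ k : {k // k ∈ G}, a k * c := (Finset.sum_coe_sort G fun k => a k * c).symm
      _ ≤ _ := Finset.sum_le_sum fun k _ => mul_le_mul_of_nonneg_left (hc k) (ha k k.2).le

/-! ### Flat vectors -/

/-- A decreasing sequence of nonzero spaces of finitely supported vectors, such that the supports
of the vectors in the `K`-th space lie beyond `K`. -/
structure IsTailSystem (V : ℕ → Submodule ℝ (ℕ+ →₀ ℝ)) : Prop where
  antitone : Antitone V
  lt : ∀ K, ∀ x ∈ V K, ∀ i ∈ x.support, K < (i : ℕ)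
  exists_ne : ∀ K, ∃ x ∈ V K, x ≠ 0

/-- Greedy recursion that carries along an upper bound of the current support. The relation `R` lets
each choice depend on the preceding one. -/
theorem exists_block_seq {α : Type*} {Good : α → Prop} {R : α → α → Prop} (S : α → Finset ℕ+)
    (h₀ : ∃ a, Good a) (h : ∀ (K : ℕ) (a : α), Good a →
      ∃ b, Good b ∧ R a b ∧ ∀ i ∈ S b, K < (i : ℕ)) :
    ∃ (s : ℕ → α) (lo hi : ℕ → ℕ+), (∀ k, lo k ≤ hi k) ∧ (∀ k, hi k < lo (k + 1)) ∧
      (∀ k, S (s k) ⊆ Finset.Icc (lo k) (hi k)) ∧ (∀ k, Good (s k)) ∧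
      ∀ k, R (s k) (s (k + 1)) := by
  let T := {q : α × ℕ+ // Good q.1 ∧ ∀ i ∈ S q.1, i ≤ q.2}
  have hnext : ∀ q : T, ∃ q' : T, R q.1.1 q'.1.1 ∧ (∀ i ∈ S q'.1.1, q.1.2 < i) ∧
      q.1.2 < q'.1.2 := by
    rintro ⟨⟨x, n⟩, hx, -⟩
    obtain ⟨b, hb, hR, hlt⟩ := h n x hx
    obtain ⟨u, hu⟩ := (S b).exists_le
    exact ⟨⟨(b, max u (n + 1)), hb, fun i hi => (hu i hi).trans (le_max_left _ _)⟩, hR,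
      fun i hi => PNat.coe_lt_coe _ _ |>.1 (hlt i hi),
      (PNat.lt_add_right n 1).trans_le (le_max_right _ _)⟩
  choose next hnR hnlt hnhi using hnext
  obtain ⟨x, hx⟩ := h₀
  obtain ⟨u, hu⟩ := (S x).exists_le
  let q : ℕ → T := fun k => Nat.rec ⟨(x, u), hx, hu⟩ (fun _ q => next q) k
  have hq : ∀ k, q (k + 1) = next (q k) := fun _ => rfl
  let lo : ℕ → ℕ+ := fun k => Nat.casesOn k 1 fun k => (q k).1.2 + 1
  refine ⟨fun k => (q k).1.1, lo, fun k => (q k).1.2, fun k => ?_, fun k => PNat.lt_add_right _ 1,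
    fun k i hi => Finset.mem_Icc.2 ⟨?_, (q k).2.2 i hi⟩, fun k => (q k).2.1, fun k => hnR (q k)⟩
  · cases k with
    | zero => exact one_le
    | succ k => exact PNat.add_one_le_iff.2 (hnhi (q k))
  · cases k with
    | zero => exact one_le
    | succ k => exact PNat.add_one_le_iff.2 (hnlt (q k) i hi)

/-- The form in which the limit condition is used. Compare the roots of the weights with 2^(-1/Q) <
1 and raise to the power M Q. -/
theorem exists_half_pow_lt (hlim : Tendsto (fun n : ℕ+ => θ n ^ (1 / ((n : ℕ) : ℝ))) atTop (𝓝 1))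
    (hθ : ∀ k, θ k ∈ Set.Ioo (0 : ℝ) 1) {Q : ℕ} (hQ : 0 < Q) :
    ∃ M, 0 < M ∧ (1 / 2 : ℝ) ^ M < weight θ (M * Q) := by
  set r : ℝ := (1 / 2 : ℝ) ^ (1 / (Q : ℝ)) with hr
  have hQ' : (0 : ℝ) < Q := by exact_mod_cast hQ
  have hr0 : 0 < r := Real.rpow_pos_of_pos (by norm_num) _
  have hr1 : r < 1 := Real.rpow_lt_one (by norm_num) (by norm_num) (by positivity)
  obtain ⟨n, hn⟩ := eventually_atTop.1 (hlim.eventually (lt_mem_nhds hr1))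
  refine ⟨n, n.pos, ?_⟩
  have hpos : 0 < (n : ℕ) * Q := Nat.mul_pos n.pos hQ
  have h := hn ⟨n * Q, hpos⟩ (PNat.coe_le_coe _ _ |>.1 (Nat.le_mul_of_pos_right _ hQ))
  rw [weight, dif_pos hpos]
  set m : ℕ+ := ⟨n * Q, hpos⟩ with hm
  have hmpos : (0 : ℝ) < ((m : ℕ) : ℝ) := by exact_mod_cast m.pos
  have h2 := Real.rpow_lt_rpow hr0.le h hmpos
  rw [← Real.rpow_mul (hθ m).1.le, one_div, inv_mul_cancel₀ hmpos.ne', Real.rpow_one, hr,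
    ← Real.rpow_mul (by norm_num)] at h2
  have e : 1 / (Q : ℝ) * ((m : ℕ) : ℝ) = ((n : ℕ) : ℝ) := by
    rw [hm, PNat.mk_coe]
    push_cast
    field_simp
  rwa [e, Real.rpow_natCast] at h2

/-- Suppose there is no such vector. Averaging blocks of norm at most 2^(-M) gives a vector flat of
order `j` with constant 2·2^(-M), so its norm must drop below 2^(-M-1), or else a multiple would be
a counterexample. Lower estimates survive the averaging at a cost of `j + 1` orders, so the weight
of order M(j+1) would be at most 2^(-M) for all M > 0. -/
theorem exists_flat (hθ : IsRegularSeq θ)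
    (hlim : Tendsto (fun n : ℕ+ => θ n ^ (1 / ((n : ℕ) : ℝ))) atTop (𝓝 1))
    {V : ℕ → Submodule ℝ (ℕ+ →₀ ℝ)} (hV : IsTailSystem V) (j K : ℕ) :
    ∃ v ∈ V K, 1 ≤ nrm θ v ∧ Flat θ j 4 v := by
  by_contra! hcon
  have hw := weight_pos hθ.mem_Ioo (j + 1)
  have claim : ∀ M K', K ≤ K' →
      ∃ x ∈ V K', nrm θ x ≤ (1 / 2) ^ M ∧ LowerEst θ (M * (j + 1)) 1 x := by
    intro M
    induction M with
    | zero =>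
      intro K' _
      obtain ⟨x, hx, hx0⟩ := hV.exists_ne K'
      have hpos := nrm_pos hθ.mem_Ioo hx0
      have h1 : nrm θ ((nrm θ x)⁻¹ • x) = 1 := by
        rw [nrm_smul, abs_of_pos (inv_pos.2 hpos), inv_mul_cancel₀ hpos.ne']
      refine ⟨(nrm θ x)⁻¹ • x, (V K').smul_mem _ hx, by simp [h1], ?_⟩
      have := lowerEst_nrm (θ := θ) (y := (nrm θ x)⁻¹ • x)
        (smul_ne_zero (inv_ne_zero hpos.ne') hx0) (0 * (j + 1))
      rwa [h1] at this
    | succ M ih =>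
      intro K' hK'
      obtain ⟨x, lo, hi, h₁, h₂, hS, hx, -⟩ := exists_block_seq (α := ℕ+ →₀ ℝ)
        (Good := fun x => x ∈ V K' ∧ nrm θ x ≤ (1 / 2) ^ M ∧ LowerEst θ (M * (j + 1)) 1 x)
        (R := fun _ _ => True) Finsupp.support (by simpa using ih K' hK') (fun L a _ => by
          obtain ⟨b, hb, hb'⟩ := ih (max K' L) (hK'.trans (le_max_left _ _))
          exact ⟨b, ⟨hV.antitone (le_max_left _ _) hb, hb'⟩, trivial, fun i hi =>
            (le_max_right _ _).trans_lt (hV.lt _ _ hb i hi)⟩)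
      -- With `δ` half the weight of order `j + 1`, the error `2 * δ * B` in `sum_average_le` equals
      -- the main term (1/2)^M.
      obtain ⟨G, a, hG, hsum, hGlo, hsmall⟩ := exists_average h₁ h₂ j (half_pos hw) 0
      have hy : ∑ k ∈ G, a k • x k ∈ V K' :=
        Submodule.sum_mem _ fun k _ => Submodule.smul_mem _ _ (hx k).1
      have hlow : LowerEst θ (M * (j + 1) + (j + 1)) 1 (∑ k ∈ G, a k • x k) :=
        LowerEst.average h₁ h₂ hS (fun k => (hx k).2.2) (fun k hk => (hG k hk).2) hsum hGlo
      refine ⟨_, hy, ?_, by rwa [Nat.succ_mul]⟩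
      have hflat : Flat θ j (2 * (1 / 2) ^ M) (∑ k ∈ G, a k • x k) := by
        intro ι _ F hF
        have hb : ∀ k, ∑ i, nrm θ (restrict (F i) (x k)) ≤ (1 / 2) ^ M / weight θ (j + 1) :=
          fun k => flat_of_nrm_le hθ.mem_Ioo (Nat.succ_pos j) (hx k).2.1 _ F
            (hF.mono (Nat.le_succ j))
        have := sum_average_le h₁ h₂ (fun k hk => (hG k hk).2.le) hsum hsmall hF
          (Exc := fun _ _ => False) (by simp) (τ := fun i k => nrm θ (restrict (F i) (x k)))
          (B := (1 / 2) ^ M / weight θ (j + 1)) (D := (1 / 2) ^ M) (by positivity) (by positivity)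
          (fun i k _ h => by
            rw [restrict_eq_zero, nrm_zero]
            intro z hz hzF
            have hz := Finset.mem_Icc.1 (hS k hz)
            exact absurd (h z hzF hz.1) hz.2.not_gt)
          (fun k _ => hb k)
          (fun i k _ _ _ _ => (nrm_restrict_le hθ.mem_Ioo _ _).trans (hx k).2.1)
        calc ∑ i, nrm θ (restrict (F i) (∑ k ∈ G, a k • x k))
            ≤ ∑ i, ∑ k ∈ G, a k * nrm θ (restrict (F i) (x k)) := by
              refine Finset.sum_le_sum fun i _ => ?_
              rw [restrict_sum]
              refine (nrm_sum_le hθ.mem_Ioo _ _).trans (Finset.sum_le_sum fun k hk => ?_)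
              rw [restrict_smul, nrm_smul, abs_of_pos (hG k hk).2]
          _ = ∑ k ∈ G, a k * ∑ i, nrm θ (restrict (F i) (x k)) := by
              rw [Finset.sum_comm]
              simp only [Finset.mul_sum]
          _ ≤ _ := this
          _ = 2 * (1 / 2) ^ M := by
              field_simp
              norm_num
      by_contra! hlt
      have hpow : (0 : ℝ) < 2 ^ (M + 1) := by positivity
      have e : (2 : ℝ) ^ (M + 1) * (1 / 2) ^ (M + 1) = 1 := by
        rw [← mul_pow]
        norm_num
      -- The scaled vector has norm at least 1 and flatness constant 2^(M+1)·2·2^(-M) = 4.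
      refine hcon ((2 : ℝ) ^ (M + 1) • ∑ k ∈ G, a k • x k)
        (Submodule.smul_mem _ _ (hV.antitone hK' hy)) ?_ ?_
      · rw [nrm_smul, abs_of_pos hpow, ← e]
        gcongr
      · refine (hflat.smul _).mono le_rfl ?_
        rw [abs_of_pos hpow]
        rw [pow_succ (1 / 2 : ℝ)] at e
        linarith
  obtain ⟨M, hM, hlt⟩ := exists_half_pow_lt hlim hθ.mem_Ioo (Nat.succ_pos j)
  obtain ⟨x, -, hx, hlow⟩ := claim M K le_rfl
  have := hlow.le_nrm hθ.mem_Ioo (Nat.mul_pos hM (Nat.succ_pos j))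
  rw [mul_one] at this
  exact absurd hlt (this.trans hx).not_gt

/-! ### Disjoint vectors with a bounded sum -/

/-- Otherwise the weights would halve every `L` orders from `j₀` on, contradicting subgeometric
decay. -/
theorem exists_weight_le_two_mul (hθ : IsRegularSeq θ)
    (hlim : Tendsto (fun n : ℕ+ => θ n ^ (1 / ((n : ℕ) : ℝ))) atTop (𝓝 1)) (L j₀ : ℕ) :
    ∃ j ≥ j₀, weight θ j ≤ 2 * weight θ (j + L) := by
  by_contra! h
  have key : ∀ M, weight θ (j₀ + M * L) ≤ (1 / 2) ^ M := by
    intro M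
    induction M with
    | zero => simpa using weight_le_one hθ.mem_Ioo j₀
    | succ M ih =>
      have := h (j₀ + M * L) (Nat.le_add_right _ _)
      rw [Nat.succ_mul, ← add_assoc, pow_succ]
      linarith
  rcases Nat.eq_zero_or_pos L with rfl | hL
  · have := h j₀ le_rfl
    have := weight_pos hθ.mem_Ioo j₀
    rw [add_zero] at *
    linarith
  · obtain ⟨M, hM, hlt⟩ := exists_half_pow_lt hlim hθ.mem_Ioo (Nat.add_pos_right j₀ hL)
    refine absurd (hlt.trans_le ((weight_antitone hθ ?_).trans (key M))) (lt_irrefl _)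
    rw [mul_add]
    exact Nat.add_le_add_right (Nat.le_mul_of_pos_left _ hM) _

theorem disjoint_support_average {lo hi : ℕ → ℕ+} (h₁ : ∀ k, lo k ≤ hi k)
    (h₂ : ∀ k, hi k < lo (k + 1)) {y y' : ℕ → ℕ+ →₀ ℝ}
    (hy : ∀ k, (y k).support ⊆ Finset.Icc (lo k) (hi k))
    (hy' : ∀ k, (y' k).support ⊆ Finset.Icc (lo k) (hi k))
    (hd : ∀ k, Disjoint (y k).support (y' k).support) (G : Finset ℕ) (a : ℕ → ℝ) :
    Disjoint (∑ k ∈ G, a k • y k).support (∑ k ∈ G, a k • y' k).support := by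
  have hmem : ∀ {y : ℕ → ℕ+ →₀ ℝ} {x : ℕ+}, x ∈ (∑ k ∈ G, a k • y k).support →
      ∃ k, x ∈ (y k).support := by
    intro y x hx
    by_contra! h
    refine Finsupp.mem_support_iff.1 hx ?_
    rw [Finsupp.finsetSum_apply]
    refine Finset.sum_eq_zero fun k _ => ?_
    rw [Finsupp.smul_apply, Finsupp.notMem_support_iff.1 (h k), smul_zero]
  rw [Finset.disjoint_left]
  intro x hx hx'
  obtain ⟨k, hk⟩ := hmem hx
  obtain ⟨l, hl⟩ := hmem hx'
  obtain rfl := block_unique h₁ h₂ (hy k hk) (hy' l hl)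
  exact Finset.disjoint_left.1 (hd k) hk hl

/-- Arbitrarily far out there are `N` disjoint vectors whose sum is flat with constant `C`, while
each of them has a lower estimate that survives an averaging of order `q`. -/
def Representable (θ : ℕ+ → ℝ) (V : ℕ → Submodule ℝ (ℕ+ →₀ ℝ)) (N : ℕ) (C : ℝ) : Prop :=
  ∀ q J : ℕ, ∃ s : Fin N → ℕ, (∀ i, 0 < s i) ∧ ∀ K, ∃ y : Fin N → ℕ+ →₀ ℝ, (∀ i, y i ∈ V K) ∧
    (∀ i i', i ≠ i' → Disjoint (y i).support (y i').support) ∧ Flat θ J C (∑ i, y i) ∧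
    ∀ i, LowerEst θ (s i) (weight θ (s i + q))⁻¹ (y i)

/-- The estimate of the sum of a block pair `v / w + z` under a piece of a norming functional. -/
theorem piece_le (hθ : IsRegularSeq θ) {p J' r m jk jk' : ℕ} {C ε w c : ℝ} {v z : ℕ+ →₀ ℝ}
    {H : Finset ℕ+} {g : (ℕ+ →₀ ℝ) →ₗ[ℝ] ℝ} (hw : 0 < w) (hε : 0 < ε) (hC : 8 ≤ C)
    (hp : weight θ (p + 1) ≤ 2 * w) (hpC : weight θ (p + 1) * C ≤ ε)
    (hJ' : 4 * weight θ J' ≤ ε * w) (hjk : J' ≤ jk) (hv : Flat θ jk 4 v)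
    (hv' : weight θ jk' * l1 v ≤ ε * w) (hz : Flat θ J' C z) (hg : Norming θ H g) (hc : 0 ≤ c)
    (hcm : c ≤ weight θ m) (hr : p + 1 ≤ m + r) (hgr : HasWeight θ r g)
    (hexc : ¬ (jk < r ∧ r < jk')) : c * g (w⁻¹ • v + z) ≤ C + ε := by
  have hc1 : c ≤ 1 := hcm.trans (weight_le_one hθ.mem_Ioo m)
  have hC0 : 0 ≤ C := by linarith
  have hcr : c * weight θ r ≤ weight θ (p + 1) :=
    (mul_le_mul_of_nonneg_right hcm (weight_pos hθ.mem_Ioo r).le).trans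
      ((weight_mul_le hθ m r).trans (weight_antitone hθ hr))
  rw [map_add, map_smul, smul_eq_mul, mul_add]
  -- For `r < J'` both vectors are flat of order `r`, and the combined factor is at most `weight θ
  -- (p + 1)`: it makes `z` contribute at most `ε` and `v / w` at most 4·2 = 8 ≤ C. For `r ≥ J'` the
  -- roles change: `z` contributes at most `C` by its norm and `v / w` at most `ε`.
  rcases lt_or_ge r J' with hrJ | hrJ
  · have h1 : c * g z ≤ ε := by
      have := mul_le_mul_of_nonneg_left (hgr C z (hz.mono hrJ.le le_rfl)) hc
      have := mul_le_mul_of_nonneg_right hcr hC0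
      linarith
    have h2 : c * (w⁻¹ * g v) ≤ 8 := by
      have := mul_le_mul_of_nonneg_left (hgr 4 v (hv.mono (hrJ.le.trans hjk) le_rfl)) hc
      have h3 : c * g v ≤ 8 * w := by linarith
      calc c * (w⁻¹ * g v) = w⁻¹ * (c * g v) := by ring
        _ ≤ w⁻¹ * (8 * w) := by gcongr
        _ = 8 := by field_simp
    linarith
  · have h1 : c * g z ≤ C := by
      have := mul_le_mul_of_nonneg_left ((hg.apply_le hθ.mem_Ioo z).trans hz.nrm_le) hc
      have := mul_le_mul_of_nonneg_right hc1 hC0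
      linarith
    have h2 : g v ≤ ε * w := by
      by_cases h : r ≤ jk
      · have := hgr 4 v (hv.mono h le_rfl)
        have := weight_antitone hθ hrJ
        linarith
      · have hr' : jk' ≤ r := by
          by_contra h'
          exact hexc ⟨not_le.1 h, not_le.1 h'⟩
        have h3 := hgr _ v (flat_l1 hθ.mem_Ioo r v)
        have h4 := mul_le_mul_of_nonneg_right (weight_antitone hθ hr') (l1_nonneg v)
        linarith
    have h3 : c * (w⁻¹ * g v) ≤ ε := by
      calc c * (w⁻¹ * g v) ≤ c * (w⁻¹ * (ε * w)) := by gcongr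
        _ = c * ε := by field_simp
        _ ≤ 1 * ε := by gcongr
        _ = ε := one_mul ε
    linarith

/-- Averages of pairs `v_k / w + z_k` are flat, if the `v_k` are flat of rapidly increasing order,
`w` is at least half the weight of the order `p + 1` and the `z_k` are flat with constant `C`. -/
theorem flat_average (hθ : IsRegularSeq θ) {p J J' : ℕ} {C ε w δ : ℝ} (hw : 0 < w) (hε : 0 < ε)
    (hC : 8 ≤ C) (hp : weight θ (p + 1) ≤ 2 * w) (hpC : weight θ (p + 1) * C ≤ ε)
    (hJ' : 4 * weight θ J' ≤ ε * w) {j : ℕ → ℕ} (hj : StrictMono j) (hjJ : ∀ k, J' ≤ j k)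
    {v z : ℕ → ℕ+ →₀ ℝ} (hv : ∀ k, Flat θ (j k) 4 (v k))
    (hv' : ∀ k, weight θ (j (k + 1)) * l1 (v k) ≤ ε * w) (hz : ∀ k, Flat θ J' C (z k))
    {lo hi : ℕ → ℕ+} (h₁ : ∀ k, lo k ≤ hi k) (h₂ : ∀ k, hi k < lo (k + 1))
    (hvs : ∀ k, (v k).support ⊆ Finset.Icc (lo k) (hi k))
    (hzs : ∀ k, (z k).support ⊆ Finset.Icc (lo k) (hi k)) {G : Finset ℕ} {a : ℕ → ℝ}
    (ha : ∀ k ∈ G, 0 ≤ a k) (hsum : ∑ k ∈ G, a k = 1)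
    (hsmall : ∀ A ⊆ G, A.image hi ∈ schreier (p + J) → ∑ k ∈ A, a k ≤ δ)
    (hδ : 2 * δ * ((4 / w + C) / weight θ (p + J + 1)) ≤ ε) :
    Flat θ J (C + 3 * ε) (∑ k ∈ G, a k • (w⁻¹ • v k + z k)) := by
  intro ι _ F hF
  obtain ⟨κ, _, H, g, c, m, hH, hle, hb⟩ := hF.frontier hθ p
    (∑ k ∈ G, a k • (w⁻¹ • v k + z k)) hε
  have hr : ∀ b, ∃ r, (∃ i, H b = {i}) ∨ p + 1 ≤ m b + r ∧ HasWeight θ r (g b) := fun b => by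
    rcases (hb b).2.2.2 with h | ⟨r, hr⟩
    · exact ⟨0, Or.inl h⟩
    · exact ⟨r, Or.inr hr⟩
  choose r hr using hr
  have hsupp : ∀ k, (w⁻¹ • v k + z k).support ⊆ Finset.Icc (lo k) (hi k) := fun k =>
    Finsupp.support_add.trans (Finset.union_subset (Finsupp.support_smul.trans (hvs k)) (hzs k))
  have hnrm : ∀ k, nrm θ (w⁻¹ • v k + z k) ≤ 4 / w + C := by
    intro k
    refine (nrm_add_le hθ.mem_Ioo _ _).trans (add_le_add ?_ (hz k).nrm_le)
    rw [nrm_smul, abs_of_pos (inv_pos.2 hw), div_eq_mul_inv, mul_comm]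
    exact mul_le_mul_of_nonneg_right (hv k).nrm_le (inv_pos.2 hw).le
  have hC0 : 0 ≤ C := by linarith
  have hwp := weight_pos hθ.mem_Ioo (p + J + 1)
  have main := sum_average_le h₁ h₂ ha hsum hsmall hH
    -- These ranges of `r` are disjoint for different `k`, so each piece has at most one exceptional
    -- block.
    (Exc := fun b k => j k < r b ∧ r b < j (k + 1))
    (fun b k l hk hl => by
      rcases lt_trichotomy k l with h | h | h
      · exact absurd (hk.2.trans_le (hj.monotone (Nat.succ_le_of_lt h))) hl.1.not_gt
      · exact h
      · exact absurd (hl.2.trans_le (hj.monotone (Nat.succ_le_of_lt h))) hk.1.not_gt)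
    (τ := fun b k => c b * g b (w⁻¹ • v k + z k))
    (B := (4 / w + C) / weight θ (p + J + 1)) (D := C + ε) (by positivity) (by positivity)
    (fun b k _ h => by
      rw [← (hb b).1.apply_restrict subset_rfl, restrict_eq_zero, map_zero, mul_zero]
      intro x hx hxH
      have hx := Finset.mem_Icc.1 (hsupp k hx)
      exact absurd (h x hxH hx.1) hx.2.not_gt)
    -- Crude bound for all pieces on one block. Passing to order `p + J + 1` makes the order
    -- positive, as the norm inequality requires.
    (fun k _ => by
      refine le_trans (Finset.sum_le_sum fun b _ => ?_) (flat_of_nrm_le hθ.mem_Ioo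
        (Nat.succ_pos (p + J)) (hnrm k) κ H (hH.mono (Nat.le_succ _)))
      obtain ⟨hg, hc, hcm, -⟩ := hb b
      calc c b * g b (w⁻¹ • v k + z k) ≤ c b * nrm θ (restrict (H b) (w⁻¹ • v k + z k)) :=
            mul_le_mul_of_nonneg_left (hg.apply_le_restrict hθ.mem_Ioo _) hc
        _ ≤ _ := mul_le_of_le_one_left (nrm_nonneg hθ.mem_Ioo _)
            (hcm.trans (weight_le_one hθ.mem_Ioo _)))
    (fun b k _ hmin ⟨x, hx, hxlo⟩ hexc => by
      obtain ⟨hg, hc, hcm, -⟩ := hb b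
      -- A piece carried by a single point cannot start before the block and also reach it.
      rcases hr b with ⟨i, hi⟩ | ⟨hmr, hwt⟩
      · have hm := minElt_mem (hH.nonempty b)
        rw [hi, Finset.mem_singleton] at hm hx
        rw [hi, hm, ← hx] at hmin
        exact absurd hxlo hmin.not_ge
      · exact piece_le hθ hw hε hC hp hpC hJ' (hjJ k) (hv k) (hv' k) (hz k) hg hc hcm hmr hwt hexc)
  have heq : ∑ b, c b * g b (∑ k ∈ G, a k • (w⁻¹ • v k + z k)) =
      ∑ k ∈ G, a k * ∑ b, c b * g b (w⁻¹ • v k + z k) := by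
    simp only [map_sum, map_smul, smul_eq_mul, Finset.mul_sum]
    rw [Finset.sum_comm]
    exact Finset.sum_congr rfl fun k _ => Finset.sum_congr rfl fun b _ => by ring
  rw [heq] at hle
  linarith

/-- The flatness order of `v (k + 1)` is chosen after `v k`, large enough to make its weight
negligible against the ℓ₁-norm of `v k`. -/
theorem exists_pair_seq (hθ : IsRegularSeq θ)
    (hlim : Tendsto (fun n : ℕ+ => θ n ^ (1 / ((n : ℕ) : ℝ))) atTop (𝓝 1))
    {V : ℕ → Submodule ℝ (ℕ+ →₀ ℝ)} (hV : IsTailSystem V) {N : ℕ}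
    {Z : (Fin N → ℕ+ →₀ ℝ) → Prop} {K : ℕ} (hZ : ∀ K, ∃ y : Fin N → ℕ+ →₀ ℝ, (∀ i, y i ∈ V K) ∧ Z y)
    (J' : ℕ) {η : ℝ} (hη : 0 < η) :
    ∃ (j : ℕ → ℕ) (v : ℕ → ℕ+ →₀ ℝ) (z : ℕ → Fin N → ℕ+ →₀ ℝ) (lo hi : ℕ → ℕ+), StrictMono j ∧
      (∀ k, J' ≤ j k) ∧ (∀ k, v k ∈ V K) ∧ (∀ k i, z k i ∈ V K) ∧ (∀ k, lo k ≤ hi k) ∧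
      (∀ k, hi k < lo (k + 1)) ∧ (∀ k, (v k).support ⊆ Finset.Icc (lo k) (hi k)) ∧
      (∀ k i, (z k i).support ⊆ Finset.Icc (lo k) (hi k)) ∧
      (∀ k i, Disjoint (v k).support (z k i).support) ∧ (∀ k, 1 ≤ nrm θ (v k)) ∧
      (∀ k, Flat θ (j k) 4 (v k)) ∧ (∀ k, weight θ (j (k + 1)) * l1 (v k) ≤ η) ∧ ∀ k, Z (z k) := by
  have build : ∀ (L j₀ : ℕ) (X : ℝ), 0 ≤ X → ∃ (j : ℕ) (v : ℕ+ →₀ ℝ) (z : Fin N → ℕ+ →₀ ℝ),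
      j₀ < j ∧ weight θ j * X ≤ η ∧ J' ≤ j ∧ v ∈ V K ∧ (∀ i, z i ∈ V K) ∧
      (∀ i, Disjoint v.support (z i).support) ∧ 1 ≤ nrm θ v ∧ Flat θ j 4 v ∧ Z z ∧
      (∀ x ∈ v.support, L < (x : ℕ)) ∧ ∀ i, ∀ x ∈ (z i).support, L < (x : ℕ) := by
    intro L j₀ X hX
    have hη' : 0 < η / (X + 1) := by positivity
    obtain ⟨j, hj, hjJ, hj₀⟩ := (((tendsto_weight hθ).eventually (gt_mem_nhds hη')).and
      ((eventually_ge_atTop J').and (eventually_gt_atTop j₀))).exists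
    obtain ⟨v, hvV, hv, hvf⟩ := exists_flat hθ hlim hV j (max K L)
    obtain ⟨u, hu⟩ := v.support.exists_le
    -- Taking `z` beyond the support of `v` makes the two disjoint.
    obtain ⟨z, hzV, hz⟩ := hZ (max (max K L) u)
    refine ⟨j, v, z, hj₀, ?_, hjJ, hV.antitone (le_max_left _ _) hvV,
      fun i => hV.antitone ((le_max_left _ _).trans (le_max_left _ _)) (hzV i), fun i => ?_, hv,
      hvf, hz, fun x hx => (le_max_right _ _).trans_lt (hV.lt _ _ hvV x hx), fun i x hx =>
        ((le_max_right _ _).trans (le_max_left _ _)).trans_lt (hV.lt _ _ (hzV i) x hx)⟩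
    · rw [lt_div_iff₀ (by positivity)] at hj
      have := weight_pos hθ.mem_Ioo j
      linarith
    · rw [Finset.disjoint_left]
      intro x hx hx'
      exact absurd ((le_max_right _ _).trans_lt (hV.lt _ _ (hzV i) x hx'))
        (not_lt.2 (PNat.coe_le_coe _ _ |>.2 (hu x hx)))
  obtain ⟨s, lo, hi, h₁, h₂, hS, hGood, hR⟩ := exists_block_seq
    (α := ℕ × (ℕ+ →₀ ℝ) × (Fin N → ℕ+ →₀ ℝ))
    (Good := fun q => J' ≤ q.1 ∧ q.2.1 ∈ V K ∧ (∀ i, q.2.2 i ∈ V K) ∧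
      (∀ i, Disjoint q.2.1.support (q.2.2 i).support) ∧ 1 ≤ nrm θ q.2.1 ∧ Flat θ q.1 4 q.2.1 ∧
      Z q.2.2)
    (R := fun q q' => q.1 < q'.1 ∧ weight θ q'.1 * l1 q.2.1 ≤ η)
    (fun q => q.2.1.support ∪ Finset.univ.biUnion fun i => (q.2.2 i).support)
    (by
      obtain ⟨j, v, z, -, -, h3, h4, h5, h6, h7, h8, h9, -⟩ := build 0 0 0 le_rfl
      exact ⟨(j, v, z), h3, h4, h5, h6, h7, h8, h9⟩)
    (fun L q _ => by
      obtain ⟨j, v, z, h1, h2, h3, h4, h5, h6, h7, h8, h9, h10, h11⟩ :=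
        build L q.1 (l1 q.2.1) (l1_nonneg _)
      refine ⟨(j, v, z), ⟨h3, h4, h5, h6, h7, h8, h9⟩, ⟨h1, h2⟩, fun x hx => ?_⟩
      rcases Finset.mem_union.1 hx with hx | hx
      · exact h10 x hx
      · obtain ⟨i, -, hx⟩ := Finset.mem_biUnion.1 hx
        exact h11 i x hx)
  exact ⟨fun k => (s k).1, fun k => (s k).2.1, fun k => (s k).2.2, lo, hi,
    strictMono_nat_of_lt_succ fun k => (hR k).1, fun k => (hGood k).1, fun k => (hGood k).2.1,
    fun k => (hGood k).2.2.1, h₁, h₂, fun k => Finset.subset_union_left.trans (hS k),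
    fun k i => ((Finset.subset_biUnion_of_mem (fun i => ((s k).2.2 i).support)
      (Finset.mem_univ i)).trans Finset.subset_union_right).trans (hS k),
    fun k => (hGood k).2.2.2.1, fun k => (hGood k).2.2.2.2.1, fun k => (hGood k).2.2.2.2.2.1,
    fun k => (hR k).2, fun k => (hGood k).2.2.2.2.2.2⟩

/-- The new vector is the average of the `v k / w`, and the old ones are replaced by averages of
their copies. The increase of the constant from `C'` to `C` pays for the errors in `flat_average`.
-/
theorem Representable.succ (hθ : IsRegularSeq θ)
    (hlim : Tendsto (fun n : ℕ+ => θ n ^ (1 / ((n : ℕ) : ℝ))) atTop (𝓝 1))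
    {V : ℕ → Submodule ℝ (ℕ+ →₀ ℝ)} (hV : IsTailSystem V) {N : ℕ} {C C' : ℝ} (hC' : 8 ≤ C')
    (hC : C' < C) (h : Representable θ V N C') : Representable θ V (N + 1) C := by
  intro q J
  obtain ⟨ε, hε, hεC⟩ : ∃ ε > 0, C' + 3 * ε ≤ C := ⟨(C - C') / 3, by linarith, by linarith⟩
  obtain ⟨j₀, hj₀⟩ := eventually_atTop.1 ((tendsto_weight hθ).eventually
    (gt_mem_nhds (div_pos hε (by linarith : 0 < C'))))
  -- The right-hand weight is the normalisation `w` that the new vector needs at order `p + J + 1`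
  -- with reserve `q`; it must be comparable to the weight gained by cutting at `p + 1`.
  obtain ⟨p, hp₀, hp⟩ : ∃ p, j₀ ≤ p + 1 ∧ weight θ (p + 1) ≤ 2 * weight θ (p + J + 1 + q) := by
    obtain ⟨j, hj, h⟩ := exists_weight_le_two_mul hθ hlim (J + q) (max j₀ 1)
    obtain ⟨p, rfl⟩ : ∃ p, j = p + 1 := ⟨j - 1, by have := le_of_max_le_right hj; omega⟩
    exact ⟨p, le_of_max_le_left hj, by rwa [show p + J + 1 + q = p + 1 + (J + q) by ring]⟩
  have hpC : weight θ (p + 1) * C' ≤ ε := by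
    have := hj₀ (p + 1) hp₀
    rw [lt_div_iff₀ (by linarith)] at this
    exact this.le
  set w := weight θ (p + J + 1 + q) with hwdef
  have hw : 0 < w := weight_pos hθ.mem_Ioo _
  have hεw : 0 < ε * w := mul_pos hε hw
  obtain ⟨J', hJ'⟩ := ((tendsto_weight hθ).eventually
    (gt_mem_nhds (div_pos hεw four_pos))).exists
  rw [lt_div_iff₀ four_pos, mul_comm] at hJ'
  -- The old vectors undergo one more averaging of order `p + J + 1`, so this much extra reserve is
  -- requested. That `s` does not depend on the position lets all blocks share the same orders.
  obtain ⟨s, hs, hrep⟩ := h (q + (p + J + 1)) J'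
  refine ⟨Fin.cons (p + J + 1) fun i => s i + (p + J + 1), fun i => ?_, fun K => ?_⟩
  · refine Fin.cases ?_ (fun i => ?_) i
    · simp
    · simp
  obtain ⟨j, v, z, lo, hi, hj, hjJ, hvV, hzV, h₁, h₂, hvs, hzs, hvz, hv1, hvf, hvl, hZ⟩ :=
    exists_pair_seq (K := K) hθ hlim hV hrep J' hεw
  have hB : 0 ≤ (4 / w + C') / weight θ (p + J + 1) :=
    div_nonneg (add_nonneg (by positivity) (by linarith)) (weight_pos hθ.mem_Ioo _).le
  set B := (4 / w + C') / weight θ (p + J + 1) with hBdef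
  obtain ⟨G, a, hG, hsum, hGlo, hsmall⟩ := exists_average h₁ h₂ (p + J)
    (δ := ε / (2 * (B + 1))) (by positivity) 0
  have hzsum : ∀ k, (∑ i, z k i).support ⊆ Finset.Icc (lo k) (hi k) := fun k x hx => by
    obtain ⟨i, -, hi⟩ := Finset.mem_biUnion.1 (Finsupp.support_finsetSum hx)
    exact hzs k i hi
  have hvs' : ∀ k, (w⁻¹ • v k).support ⊆ Finset.Icc (lo k) (hi k) := fun k =>
    Finsupp.support_smul.trans (hvs k)
  have hvz' : ∀ k i, Disjoint (w⁻¹ • v k).support (z k i).support := fun k i =>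
    (hvz k i).mono_left Finsupp.support_smul
  have hflat := flat_average hθ hw hε hC' hp hpC hJ'.le hj hjJ hvf hvl (fun k => (hZ k).2.1) h₁ h₂
    hvs hzsum (fun k hk => (hG k hk).2.le) hsum hsmall (by
      rw [← hBdef]
      calc 2 * (ε / (2 * (B + 1))) * B = ε * (B / (B + 1)) := by field_simp
        _ ≤ ε * 1 := by
          gcongr
          rw [div_le_one (by positivity)]
          linarith
        _ = ε := mul_one ε)
  refine ⟨Fin.cons (∑ k ∈ G, a k • (w⁻¹ • v k)) fun i => ∑ k ∈ G, a k • z k i, fun i => ?_, ?_, ?_,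
    fun i => ?_⟩
  · refine Fin.cases ?_ (fun i => ?_) i
    · exact Submodule.sum_mem _ fun k _ =>
        Submodule.smul_mem _ _ (Submodule.smul_mem _ _ (hvV k))
    · exact Submodule.sum_mem _ fun k _ => Submodule.smul_mem _ _ (hzV k i)
  · intro i i'
    refine Fin.cases (Fin.cases (fun h => absurd rfl h) fun i' _ => ?_) (fun i => Fin.cases
      (fun _ => ?_) fun i' hne => ?_) i i'
    · exact disjoint_support_average h₁ h₂ hvs' (fun k => hzs k i') (fun k => hvz' k i') G a
    · exact (disjoint_support_average h₁ h₂ hvs' (fun k => hzs k i) (fun k => hvz' k i) G a).symm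
    · exact disjoint_support_average h₁ h₂ (fun k => hzs k i) (fun k => hzs k i')
        (fun k => (hZ k).1 i i' fun h => hne (by rw [h])) G a
  · have e : ∑ i, (Fin.cons (∑ k ∈ G, a k • (w⁻¹ • v k)) (fun i => ∑ k ∈ G, a k • z k i) :
        Fin (N + 1) → ℕ+ →₀ ℝ) i = ∑ k ∈ G, a k • (w⁻¹ • v k + ∑ i, z k i) := by
      rw [Fin.sum_univ_succ]
      simp only [Fin.cons_zero, Fin.cons_succ, smul_add, Finset.sum_add_distrib, Finset.smul_sum]
      rw [Finset.sum_comm]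
    rw [e]
    exact hflat.mono le_rfl hεC
  · refine Fin.cases ?_ (fun i => ?_) i
    · have : ∀ k, LowerEst θ 0 w⁻¹ (w⁻¹ • v k) := by
        intro k
        have hne : w⁻¹ • v k ≠ 0 := by
          refine smul_ne_zero (inv_ne_zero hw.ne') fun h0 => ?_
          have := hv1 k
          rw [h0, nrm_zero] at this
          linarith
        obtain ⟨ι, inst, F, hF, hFs, hc⟩ := lowerEst_nrm (θ := θ) hne 0
        refine ⟨ι, inst, F, hF, hFs, le_trans ?_ hc⟩
        rw [nrm_smul, abs_of_pos (inv_pos.2 hw)]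
        exact le_mul_of_one_le_right (inv_pos.2 hw).le (hv1 k)
      have := LowerEst.average h₁ h₂ hvs' this (fun k hk => (hG k hk).2) hsum hGlo
      rw [zero_add] at this
      exact this
    · have := LowerEst.average h₁ h₂ (fun k => hzs k i) (fun k => (hZ k).2.2 i)
        (fun k hk => (hG k hk).2) hsum hGlo
      simp only [Fin.cons_succ]
      rwa [show s i + (p + J + 1) + q = s i + (q + (p + J + 1)) by ring]

/-- The constant increases at every step, but it can be kept below any `C > 8` by starting each step
from the midpoint `(C + 8) / 2`. -/
theorem representable (hθ : IsRegularSeq θ)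
    (hlim : Tendsto (fun n : ℕ+ => θ n ^ (1 / ((n : ℕ) : ℝ))) atTop (𝓝 1))
    {V : ℕ → Submodule ℝ (ℕ+ →₀ ℝ)} (hV : IsTailSystem V) (N : ℕ) :
    ∀ C > 8, Representable θ V N C := by
  induction N with
  | zero =>
    intro C hC q J
    refine ⟨Fin.elim0, fun i => i.elim0, fun K => ⟨Fin.elim0, fun i => i.elim0, fun i => i.elim0,
      fun ι _ F _ => ?_, fun i => i.elim0⟩⟩
    have : ∀ i, restrict (F i) 0 = 0 := fun i => restrict_eq_zero (by simp)
    simp only [Finset.univ_eq_empty, Finset.sum_empty, this, nrm_zero, Finset.sum_const_zero]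
    linarith
  | succ N ih =>
    intro C hC
    exact (ih ((C + 8) / 2) (by linarith)).succ hθ hlim hV (by linarith) (by linarith)

theorem exists_disjoint_nrm_sum_le (hθ : IsRegularSeq θ)
    (hlim : Tendsto (fun n : ℕ+ => θ n ^ (1 / ((n : ℕ) : ℝ))) atTop (𝓝 1))
    {V : ℕ → Submodule ℝ (ℕ+ →₀ ℝ)} (hV : IsTailSystem V) (N : ℕ) :
    ∃ y : Fin N → ℕ+ →₀ ℝ, (∀ i, y i ∈ V 0) ∧
      (∀ i i', i ≠ i' → Disjoint (y i).support (y i').support) ∧ (∀ i, 1 ≤ nrm θ (y i)) ∧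
      nrm θ (∑ i, y i) ≤ 9 := by
  obtain ⟨s, hs, h⟩ := representable hθ hlim hV N 9 (by norm_num) 0 0
  obtain ⟨y, hyV, hyd, hyf, hyl⟩ := h 0
  refine ⟨y, hyV, hyd, fun i => ?_, hyf.nrm_le⟩
  have := (hyl i).le_nrm hθ.mem_Ioo (hs i)
  rwa [add_zero, mul_inv_cancel₀ (weight_pos hθ.mem_Ioo _).ne'] at this

/-! ### Improving the constant -/

/-- James's argument. If the sum of any `n` admissible vectors exceeded `1 + ε`, grouping n^s of
them in a tree of depth `s` would force the sum above (1+ε)^s, contradicting the uniform bound `C`.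
-/
theorem exists_disjoint_nrm_sum_le_one_add {W : Submodule ℝ (ℕ+ →₀ ℝ)} {C : ℝ}
    (hW : ∀ N, ∃ y : Fin N → ℕ+ →₀ ℝ, (∀ i, y i ∈ W) ∧
      (∀ i i', i ≠ i' → Disjoint (y i).support (y i').support) ∧ (∀ i, 1 ≤ nrm θ (y i)) ∧
      nrm θ (∑ i, y i) ≤ C) {ε : ℝ} (hε : 0 < ε) (n : ℕ) :
    ∃ y : Fin n → ℕ+ →₀ ℝ, (∀ i, y i ∈ W) ∧
      (∀ i i', i ≠ i' → Disjoint (y i).support (y i').support) ∧ (∀ i, 1 ≤ nrm θ (y i)) ∧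
      nrm θ (∑ i, y i) ≤ 1 + ε := by
  by_contra! hcon
  have claim : ∀ (s : ℕ) (y : (Fin s → Fin n) → ℕ+ →₀ ℝ), (∀ i, y i ∈ W) →
      (∀ i i', i ≠ i' → Disjoint (y i).support (y i').support) → (∀ i, 1 ≤ nrm θ (y i)) →
      (1 + ε) ^ s ≤ nrm θ (∑ i, y i) := by
    intro s
    induction s with
    | zero =>
      intro y _ _ hy
      rw [Fintype.sum_unique, pow_zero]
      exact hy _
    | succ s ih =>
      intro y hyW hyd hy
      have hp : (0 : ℝ) < (1 + ε) ^ s := by positivity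
      let z : Fin n → ℕ+ →₀ ℝ := fun r => ∑ t, y (Fin.cons r t)
      have hz : ∑ r, z r = ∑ i, y i := by
        rw [← (Fin.consEquiv fun _ => Fin n).sum_comp, Fintype.sum_prod_type]
        rfl
      have hinj : ∀ r, Function.Injective fun t : Fin s → Fin n =>
          (Fin.cons r t : Fin (s + 1) → Fin n) := fun r t t' h =>
        (Fin.cons_inj.1 h).2
      -- The subtree sums have norm at least (1+ε)^s by induction, so after rescaling they are again
      -- disjoint vectors of norm at least 1.
      have hlt := hcon (fun r => ((1 + ε) ^ s)⁻¹ • z r)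
        (fun r => W.smul_mem _ (W.sum_mem fun t _ => hyW _))
        (fun r r' hr => by
          refine Disjoint.mono Finsupp.support_smul Finsupp.support_smul ?_
          rw [Finset.disjoint_left]
          intro x hx hx'
          obtain ⟨t, -, ht⟩ := Finset.mem_biUnion.1 (Finsupp.support_finsetSum hx)
          obtain ⟨t', -, ht'⟩ := Finset.mem_biUnion.1 (Finsupp.support_finsetSum hx')
          exact Finset.disjoint_left.1 (hyd _ _ fun h => hr (Fin.cons_inj.1 h).1) ht ht')
        (fun r => by
          rw [nrm_smul, abs_of_pos (inv_pos.2 hp), ← div_eq_inv_mul, one_le_div hp]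
          exact ih _ (fun t => hyW _) (fun t t' h => hyd _ _ ((hinj r).ne h)) fun t => hy _)
      rw [← Finset.smul_sum, nrm_smul, abs_of_pos (inv_pos.2 hp), hz, ← div_eq_inv_mul,
        lt_div_iff₀ hp] at hlt
      rw [pow_succ, mul_comm]
      exact hlt.le
  obtain ⟨s, hs⟩ := pow_unbounded_of_one_lt C (lt_add_of_pos_right 1 hε)
  let e := Fintype.equivFin (Fin s → Fin n)
  obtain ⟨y, hyW, hyd, hy, hyC⟩ := hW (Fintype.card (Fin s → Fin n))
  have := claim s (fun i => y (e i)) (fun i => hyW _) (fun i i' h => hyd _ _ (e.injective.ne h))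
    fun i => hy _
  rw [e.sum_comp y] at this
  exact absurd hs (this.trans hyC).not_gt

/-! ### Block subspaces -/

theorem IsBlockSequence.lt_of_mem_support {u : ℕ → ℕ+ →₀ ℝ} (hu : IsBlockSequence u) (k : ℕ) :
    ∀ i ∈ (u k).support, k < (i : ℕ) := by
  induction k with
  | zero => exact fun i _ => i.pos
  | succ k ih =>
    intro i hi
    obtain ⟨c, hc⟩ := Finsupp.support_nonempty_iff.2 (hu.1 k)
    exact (Nat.succ_le_of_lt (ih c hc)).trans_lt (PNat.coe_lt_coe _ _ |>.2 (hu.2 k c hc i hi))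

theorem IsBlockSequence.isTailSystem {u : ℕ → ℕ+ →₀ ℝ} (hu : IsBlockSequence u) :
    IsTailSystem fun K => Submodule.span ℝ (u '' Set.Ici K) where
  antitone _ _ h := Submodule.span_mono (Set.image_mono (Set.Ici_subset_Ici.2 h))
  lt K x hx := by
    induction hx using Submodule.span_induction with
    | mem x hx =>
      obtain ⟨k, hk, rfl⟩ := hx
      exact fun i hi => lt_of_le_of_lt hk (hu.lt_of_mem_support k i hi)
    | zero => simp
    | add x y _ _ hx hy =>
      intro i hi
      rcases Finset.mem_union.1 (Finsupp.support_add hi) with h | h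
      · exact hx i h
      · exact hy i h
    | smul c x _ hx => exact fun i hi => hx i (Finsupp.support_smul hi)
  exists_ne K := ⟨u K, Submodule.subset_span ⟨K, Set.mem_Ici.2 le_rfl, rfl⟩, hu.1 K⟩

/-! ### Transfer to the completion -/

section Space

variable {M : ℕ+ → Set (Finset ℕ+)} {hθ : ∀ k, θ k ∈ Set.Ioo (0 : ℝ) 1}

theorem ofC00_add (x y : ℕ+ →₀ ℝ) :
    (ofC00 (x + y) : Space M θ hθ) = ofC00 x + ofC00 y :=
  UniformSpace.Completion.coe_add (α := PreSpace M θ hθ) x y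

theorem ofC00_smul (c : ℝ) (x : ℕ+ →₀ ℝ) : (ofC00 (c • x) : Space M θ hθ) = c • ofC00 x :=
  UniformSpace.Completion.coe_smul (X := PreSpace M θ hθ) c x

theorem ofC00_zero : (ofC00 0 : Space M θ hθ) = 0 :=
  UniformSpace.Completion.coe_zero (α := PreSpace M θ hθ)

theorem ofC00_sum {ι : Type*} (s : Finset ι) (x : ι → ℕ+ →₀ ℝ) :
    (ofC00 (∑ i ∈ s, x i) : Space M θ hθ) = ∑ i ∈ s, ofC00 (x i) := by
  classical
  induction s using Finset.induction_on with
  | empty => simp [ofC00_zero]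
  | insert i s hi ih => rw [Finset.sum_insert hi, Finset.sum_insert hi, ofC00_add, ih]

theorem supp_ofC00 (x : ℕ+ →₀ ℝ) : supp (ofC00 x : Space M θ hθ) = x.support := by
  ext i
  simp [supp, coord_ofC00]

theorem ofC00_mem_of_mem_span {Y : Submodule ℝ (Space M θ hθ)} {A : Set (ℕ+ →₀ ℝ)}
    (hA : ∀ x ∈ A, ofC00 x ∈ Y) {x : ℕ+ →₀ ℝ} (hx : x ∈ Submodule.span ℝ A) : ofC00 x ∈ Y := by
  induction hx using Submodule.span_induction with
  | mem x hx => exact hA x hx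
  | zero => exact ofC00_zero (M := M) (hθ := hθ) ▸ Y.zero_mem
  | add x y _ _ hx hy => exact ofC00_add (M := M) (hθ := hθ) x y ▸ Y.add_mem hx hy
  | smul c x _ hx => exact ofC00_smul (M := M) (hθ := hθ) c x ▸ Y.smul_mem c hx

end Space

/-! ### Unconditional estimates for disjoint vectors and the conclusion -/

theorem sum_disjoint_apply {n : ℕ} {y : Fin n → ℕ+ →₀ ℝ}
    (hd : ∀ i i', i ≠ i' → Disjoint (y i).support (y i').support) (a : Fin n → ℝ) {i : Fin n}
    {x : ℕ+} (hx : x ∈ (y i).support) : (∑ j, a j • y j) x = a i * y i x := by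
  rw [Finsupp.finsetSum_apply, Finset.sum_eq_single i]
  · rfl
  · intro j _ hj
    rw [Finsupp.smul_apply, Finsupp.notMem_support_iff.1
      (Finset.disjoint_left.1 (hd i j hj.symm) hx), smul_zero]
  · exact fun h => absurd (Finset.mem_univ i) h

theorem nrm_sum_disjoint_le (hθ : ∀ k, θ k ∈ Set.Ioo (0 : ℝ) 1) {n : ℕ} {y : Fin n → ℕ+ →₀ ℝ}
    (hd : ∀ i i', i ≠ i' → Disjoint (y i).support (y i').support) (a : Fin n → ℝ) :
    nrm θ (∑ i, a i • y i) ≤ ‖a‖ * nrm θ (∑ i, y i) := by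
  have h := nrm_lattice hθ (x := ∑ i, a i • y i) (y := ‖a‖ • ∑ i, y i) fun x => by
    by_cases hx : ∃ i, x ∈ (y i).support
    · obtain ⟨i, hi⟩ := hx
      have h1 := sum_disjoint_apply hd (fun _ => 1) hi
      simp only [one_smul, one_mul] at h1
      rw [sum_disjoint_apply hd a hi, Finsupp.smul_apply, h1, smul_eq_mul, abs_mul, abs_mul,
        abs_norm]
      exact mul_le_mul_of_nonneg_right (norm_le_pi_norm a i) (abs_nonneg _)
    · push Not at hx
      rw [Finsupp.finsetSum_apply, Finset.sum_eq_zero, abs_zero]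
      · exact abs_nonneg _
      · intro i _
        rw [Finsupp.smul_apply, Finsupp.notMem_support_iff.1 (hx i), smul_zero]
  rwa [nrm_smul, abs_norm] at h

theorem norm_le_nrm_sum_disjoint (hθ : ∀ k, θ k ∈ Set.Ioo (0 : ℝ) 1) {n : ℕ}
    {y : Fin n → ℕ+ →₀ ℝ} (hd : ∀ i i', i ≠ i' → Disjoint (y i).support (y i').support)
    (hy : ∀ i, 1 ≤ nrm θ (y i)) (a : Fin n → ℝ) : ‖a‖ ≤ nrm θ (∑ i, a i • y i) := by
  refine (pi_norm_le_iff_of_nonneg (nrm_nonneg hθ _)).2 fun i => ?_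
  calc ‖a i‖ ≤ |a i| * nrm θ (y i) := le_mul_of_one_le_right (abs_nonneg _) (hy i)
    _ = nrm θ (a i • y i) := (nrm_smul _ _).symm
    _ ≤ _ := nrm_lattice hθ fun x => by
      by_cases hx : x ∈ (y i).support
      · rw [sum_disjoint_apply hd a hx, Finsupp.smul_apply, smul_eq_mul]
      · rw [Finsupp.smul_apply, Finsupp.notMem_support_iff.1 hx, smul_zero, abs_zero]
        exact abs_nonneg _

end MixedTsirelson

theorem theorem1p6 (θ : ℕ+ → ℝ) (hθ : MixedTsirelson.IsRegularSeq θ)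
    (hlim : Tendsto (fun n : ℕ+ => θ n ^ (1 / ((n : ℕ) : ℝ))) atTop (𝓝 1))
    (ε : ℝ) (hε : 0 < ε)
    (Y : Submodule ℝ (MixedTsirelson.Space (fun n => MixedTsirelson.schreier n) θ hθ.mem_Ioo))
    (hY : MixedTsirelson.IsBlockSubspace Y) (n : ℕ) :
    ∃ y : Fin n → MixedTsirelson.Space (fun n => MixedTsirelson.schreier n) θ hθ.mem_Ioo,
      (∀ i, y i ∈ Y) ∧
      (∀ i j, i ≠ j → Disjoint (MixedTsirelson.supp (y i)) (MixedTsirelson.supp (y j))) ∧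
      MixedTsirelson.IsEquivalentSeq (1 + ε) y
        (fun i => (Pi.single i (1 : ℝ) : Fin n → ℝ)) := by
  open MixedTsirelson in
  obtain ⟨u, hu, rfl⟩ := hY
  obtain ⟨y, hyV, hyd, hy1, hy⟩ := exists_disjoint_nrm_sum_le_one_add
    (exists_disjoint_nrm_sum_le hθ hlim hu.isTailSystem) hε n
  refine ⟨fun i => ofC00 (y i), fun i => Submodule.le_topologicalClosure _ ?_, fun i j hij => ?_,
    1, 1 + ε, one_pos, by linarith, by rw [one_mul], fun a => ?_⟩
  · refine ofC00_mem_of_mem_span (fun x hx => ?_) (hyV i)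
    obtain ⟨k, -, rfl⟩ := hx
    exact Submodule.subset_span ⟨k, rfl⟩
  · rw [supp_ofC00, supp_ofC00]
    exact Finset.disjoint_coe.2 (hyd i j hij)
  · have e : ∑ i, a i • (Pi.single i (1 : ℝ) : Fin n → ℝ) = a := by
      ext j
      simp [Pi.single_apply]
    simp only [e, ← ofC00_smul, ← ofC00_sum, norm_ofC00, inv_one, one_mul]
    refine ⟨norm_le_nrm_sum_disjoint hθ.mem_Ioo hyd hy1 a, ?_⟩
    rw [mul_comm]
    exact (nrm_sum_disjoint_le hθ.mem_Ioo hyd a).trans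
      (mul_le_mul_of_nonneg_left hy (norm_nonneg a))
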